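/- **Theorem (global differential privacy).** *Setting.* Reliable agents $i\in\mathcal R$ and Byzantine agents $b\in\mathcal B$ form a finite network. Every reliable agent $i$ holds $Q$ samples $\xi_{i,1},\dots,\xi_{i,Q}$ and has differentiable sample losses $x\mapsto f_i(x;\xi)$ on $\mathbb R^n$. Starting from given $x_{i,0}$, for $k=0,\dots,K-1$ every reliable agent $i$ draws a batch $S_{i,k}\subset\{1,\dots,Q\}$ of size $B_s$ ($1\le B_s\le Q$) uniformly without replacement, forms the masked gradient $$\tilde g_{i,k}=\frac1{B_s}\sum_{q\in S_{i,k}}\nabla f_i(x_{i,k};\xi_{i,q})+\tilde n_{i,k},\qquad \tilde n_{i,k}\sim N(0,\tilde\varpi_{i,k}^2\mathbf I),$$ transmits $\tilde x_{i,k}=x_{i,k}-\alpha_k\tilde g_{i,k}$, receives models $\tilde x^i_{j,k}$ from the agents $j$ (with $\tilde x^i_{j,k}=\tilde x_{j,k}$ for $j\in\mathcal R$), and sets $$x_{i,k+1}=\sum_{j\in\mathcal N_i}w_{ij}\Bigl(\tilde x_{i,k}+\mathrm{Clip}\{\tilde x^i_{j,k}-\tilde x_{i,k},\tau_i\}\Bigr),\qquad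 \mathrm{Clip}\{v,\tau\}=v\min\{1,\tau/\|v\|_2\}.$$ All batches and noises are independent of each other and of the private randomness of the Byzantine agents. The parameters $\tau_i$ may depend measurably on $k$ and on the received models. At each iteration a Byzantine agent may send to each reliable agent an arbitrary vector that is a measurable function of the randomness of the Byzantine agents and of all masked gradients, models and messages up to and including the current iteration. Two collections of samples are adjacent if they differ in at most one sample of one reliable agent. A randomized mechanism $h$ is $(\epsilon,\delta)$-DP if $\mathrm{Prob}\{h(D)\in T\}\le e^{\epsilon}\,\mathrm{Prob}\{h(D')\in T\}+\delta$ for all adjacent $D,D'$ and all measurable sets $T$. *Claim.* Let $K\ge1$, $0<\delta\le1$, $B_g>0$, $\varpi>0$, and suppose that $\|\nabla f_i(x;\xi)\|_2\le B_g$ for all $x\in\mathbb R^n$, all $i\in\mathcal R$ and all samples $\xi$, and that $\tilde\varpi_{i,k}\ge\varpi$ for all $i,k$ (in particular, $\tilde\varpi_{i,k}=\varpi$ is allowed). Let $$o_r:=1+\frac{\varpi Q}{B_g}\sqrt{\frac{\log(1/\delta)}{20K}}$$ be the order of the Rényi divergence at which the privacy loss is evaluated. If $$\varpi^2\ge\frac{6B_g^2}{B_s^2}\qquad\text{and}\qquad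 o_r\le-\log\left(\frac{B_s}{Q}\left(\frac{\varpi^2B_s^2}{4B_g^2}+1\right)\right),$$ then the whole algorithm, releasing all masked gradients $\tilde g_{i,k}$, all transmitted models $\tilde x_{i,k}$, all messages and the randomness of the Byzantine agents, and all decision variables $x_{i,k}$, $0\le k\le K$, of the reliable agents, is $(\epsilon,\delta)$-DP with $$\epsilon=\frac{20B_g^2K}{\varpi^2Q^2}+\frac{2B_g\sqrt{20K\log(1/\delta)}}{\varpi Q}.$$ -/

import Mathlib

open MeasureTheory ProbabilityTheory

noncomputable section

namespace DPSCC

/-- The decision space `ℝⁿ` with the Euclidean norm. -/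
abbrev Vec (n : ℕ) : Type := EuclideanSpace ℝ (Fin n)

/-- `(ε, δ)`-differential privacy of a randomised mechanism `h`. The input `x` ranges over `X`,
the randomness `ω` has law `P`, and `h x ω` is what the mechanism releases. -/
def IsDP {X Ω Y : Type*} [MeasurableSpace Ω] [MeasurableSpace Y] (P : Measure Ω)
    (Adj : X → X → Prop) (h : X → Ω → Y) (ε δ : ℝ) : Prop :=
  ∀ x x' : X, Adj x x' → ∀ T : Set Y, MeasurableSet T →
    P.real {ω | h x ω ∈ T} ≤ Real.exp ε * P.real {ω | h x' ω ∈ T} + δ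

/-- Two collections of local samples (agent `i` holds the samples `D i q`, `q < Q`) are adjacent
if they differ in at most one sample of one agent. -/
def Adjacent {R Ξ : Type*} {Q : ℕ} (D D' : R → Fin Q → Ξ) : Prop :=
  ∃ (i : R) (q : Fin Q), ∀ (j : R) (p : Fin Q), (j, p) ≠ (i, q) → D j p = D' j p

/-- `Clip{v, τ} = v · min{1, τ / ‖v‖₂}`. -/
def clip {n : ℕ} (v : Vec n) (τ : ℝ) : Vec n := min 1 (τ / ‖v‖) • v

/-- The public data of a run: `R` and `B` are the reliable and the Byzantine agents, so that
`R ⊕ B` is the set of all agents, and `U` is the source of randomness of the Byzantine agents. -/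
structure Setup (R B U : Type*) (n : ℕ) where
  /-- initial decision variables `x_{i,0}` -/
  x0 : R → Vec n
  /-- step sizes `α_k` -/
  stepSize : ℕ → ℝ
  /-- the agents whose messages are aggregated by a reliable agent -/
  nbr : R → Finset (R ⊕ B)
  /-- weights `w_{ij}` -/
  weight : R → R ⊕ B → ℝ
  /-- clipping parameters `τ_i`, which may depend on the iteration and on the messages received -/
  clipRadius : ℕ → R → (R ⊕ B → Vec n) → ℝ
  /-- the attack: `attack k u g b i` is the vector which the Byzantine agent `b` sends to the
  reliable agent `i` at iteration `k`, given the seed `u` and the masked gradients `g` of all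
  reliable agents at the iterations `0, …, k`. (The public data, `u` and `g` determine all decision
  variables and all messages up to iteration `k`, see `decision` and `transmitted`.) -/
  attack : (k : ℕ) → U → (Fin (k + 1) → R → Vec n) → B → R → Vec n

variable {R B U Ξ : Type*} {n Q : ℕ}

/-- The self-centred clipping rule of the reliable agent `i` at iteration `k`, applied to the
agent's own model `own` and to the models `recv j` received from the agents `j`. -/
def Setup.scc (A : Setup R B U n) (k : ℕ) (i : R) (own : Vec n) (recv : R ⊕ B → Vec n) : Vec n :=
  ∑ j ∈ A.nbr i, A.weight i j • (own + clip (recv j - own) (A.clipRadius k i recv))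

/-- The decision variables `x_{i,k}` of the reliable agents, as they result from the masked
gradients `g` of the iterations `0, …, k - 1` and from the seed `u` of the Byzantine agents:
`x̃_{i,k} = x_{i,k} - α_k g̃_{i,k}` is transmitted, then the received models are aggregated. -/
def Setup.decision (A : Setup R B U n) (u : U) : (k : ℕ) → (Fin k → R → Vec n) → R → Vec n
  | 0, _ => A.x0
  | k + 1, g => fun i =>
      let x : R → Vec n := A.decision u k (Fin.init g)
      let y : R → Vec n := fun j => x j - A.stepSize k • g (Fin.last k) j
      A.scc k i (y i) (Sum.elim y (fun b => A.attack k u g b i))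

/-- The stochastic gradient of an agent with samples `d`, at `x`, for the mini-batch `S` of
size `Bs`: the mean of the gradients (in `x`) of the losses of the samples in the batch. -/
def stochGrad (f : Ξ → Vec n → ℝ) (d : Fin Q → Ξ) (Bs : ℕ) (S : Finset (Fin Q)) (x : Vec n) :
    Vec n :=
  (Bs : ℝ)⁻¹ • ∑ q ∈ S, gradient (f (d q)) x

/-- The masked gradients `g̃_{i,l}`, `l < k`, produced by the algorithm on the samples `D`.
`ω l i` consists of the mini-batch and of the noise of agent `i` at iteration `l`. -/
def Setup.masked (A : Setup R B U n) (f : R → Ξ → Vec n → ℝ) (D : R → Fin Q → Ξ) (Bs : ℕ)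
    (u : U) : (k : ℕ) → (Fin k → R → Finset (Fin Q) × Vec n) → Fin k → R → Vec n
  | 0, _ => Fin.elim0
  | k + 1, ω =>
      let g : Fin k → R → Vec n := A.masked f D Bs u k (Fin.init ω)
      Fin.snoc (α := fun _ => R → Vec n) g (fun i =>
        stochGrad (f i) (D i) Bs (ω (Fin.last k) i).1 (A.decision u k g i) + (ω (Fin.last k) i).2)

/-- The part of a history of length `K` that precedes iteration `k ≤ K`. -/
def prefixOf {α : Type*} {K : ℕ} (g : Fin K → α) (k : ℕ) (hk : k ≤ K) : Fin k → α :=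
  fun l => g (Fin.castLE hk l)

/-- The models `x̃_{i,k}`, `k < K`, which the reliable agents transmit. -/
def Setup.transmitted (A : Setup R B U n) (u : U) {K : ℕ} (g : Fin K → R → Vec n)
    (k : Fin K) (i : R) : Vec n :=
  A.decision u k (prefixOf g k k.2.le) i - A.stepSize k • g k i

/-- Everything that `K` iterations of the algorithm release: the seed of the Byzantine agents,
all masked gradients `g̃_{i,k}`, all models `x̃_{i,k}` transmitted by reliable agents, all messages
sent by Byzantine agents, and all decision variables `x_{i,k}`, `0 ≤ k ≤ K`. -/
abbrev View (R B U : Type*) (n K : ℕ) : Type _ :=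
  U × (Fin K → R → Vec n) × (Fin K → R → Vec n) × (Fin K → B → R → Vec n) ×
    (Fin (K + 1) → R → Vec n)

/-- The whole algorithm with `K` iterations, run on the samples `D` with randomness `ω`. -/
def Setup.algorithm (A : Setup R B U n) (f : R → Ξ → Vec n → ℝ) (Bs K : ℕ)
    (D : R → Fin Q → Ξ) (ω : U × (Fin K → R → Finset (Fin Q) × Vec n)) : View R B U n K :=
  let g : Fin K → R → Vec n := A.masked f D Bs ω.1 K ω.2
  (ω.1, g, A.transmitted ω.1 g,
    fun k => A.attack k ω.1 (prefixOf g (k + 1) k.2),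
    fun k => A.decision ω.1 k (prefixOf g k (Nat.lt_succ_iff.mp k.2)))

/-- The Gaussian law `N(0, σ² I)` on `ℝⁿ`. -/
def gaussianNoise (n : ℕ) (σ : ℝ) : Measure (Vec n) :=
  (stdGaussian (Vec n)).map (fun z => σ • z)

/-- The uniform law on the mini-batches of size `Bs` (drawn without replacement from `Q` samples). -/
def batchLaw (Q Bs : ℕ) : Measure (Finset (Fin Q)) :=
  uniformOn {S : Finset (Fin Q) | S.card = Bs}

/-- The law of the randomness: the seed of the Byzantine agents has law `ν`, agent `i` draws at
iteration `k` a uniform mini-batch and noise of law `N(0, (σ i k)² I)`, all of it independent. -/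
def randomness [Fintype R] [MeasurableSpace U] (ν : Measure U) (n Q Bs K : ℕ) (σ : R → ℕ → ℝ) :
    Measure (U × (Fin K → R → Finset (Fin Q) × Vec n)) :=
  ν.prod (Measure.pi fun k : Fin K => Measure.pi fun i : R =>
    (batchLaw Q Bs).prod (gaussianNoise n (σ i k)))

end DPSCC

end

/-! Privacy loss is tracked in dual Rényi form: for conjugate exponents `p`, `α`, laws P, P' satisfy
E_P F ≤ C (E_P' F^p)^(1/p) for all measurable F ≥ 0. By Hölder this holds when C^α bounds the α-th
moment of dP/dP' under P'. The dual form needs no densities of the whole process. It multiplies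
under adaptive composition, survives averaging over anything common to both runs (other agents,
seed) by Jensen, and for indicators F it compares probabilities. Models, messages and attacks are
measurable functions of the seed and the masked gradients, hence mere post-processing.

One iteration: only one agent i and one sample a differ. Each batch S without a is paired with the
batches obtained by exchanging some r ∈ S for a. Given the pair, the masked gradient is a mixture of
two Gaussians with weights 1 - q and q, q = Bs/Q. The first component is the same for both data
sets, and the three means involved are within squared distance uσ², where u = 4Bg²/(ϖ²Bs²) ≤ 2/3.

The moment of the two mixtures is at most 1 + 5α(α-1)q²u (`lintegral_mixture_ratio_rpow_le`).
Indeed, expand r^α at 1 in the likelihood ratio r: the linear term integrates to zero, the quadratic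
term is a χ²-type quantity of order q²u, and the excess of the remainder, where r is large, is
negligible because q ≤ e^(-α) u/(1+u), which is what the condition on the order says.

Composing K iterations gives C^K ≤ exp((α-1)a) with a = 20Bg²K/(ϖ²Q²). The conversion
`le_exp_mul_add_of_le_exp_mul_rpow` yields ε = aα + log(1/δ)/(α-1), and the prescribed order
minimises this expression. -/

/-! ### Elementary inequalities for real powers and exponentials. -/

section RealInequalities

/-- Second order upper bound for `r ^ α` around `1`, for exponents between `1` and `2`. -/
theorem rpow_le_quadratic_of_le_two {α r : ℝ} (h1 : 1 ≤ α) (h2 : α ≤ 2) (hr : 0 ≤ r) :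
    r ^ α ≤ 1 + α * (r - 1) + (α - 1) * (r - 1) ^ 2 := by
  rcases hr.eq_or_lt with rfl | hr
  · rw [Real.zero_rpow (by linarith)]; nlinarith
  -- Bernoulli for the exponent α - 1 ∈ [0, 1]; multiplying by r = 1 + (r - 1) gives the quadratic
  -- exactly.
  have h := rpow_one_add_le_one_add_mul_self (s := r - 1) (by linarith) (p := α - 1)
    (by linarith) (by linarith)
  rw [add_sub_cancel] at h
  have e : r ^ α = r * r ^ (α - 1) := by
    rw [Real.rpow_sub_one hr.ne']; field_simp
  rw [e]
  nlinarith [mul_le_mul_of_nonneg_left h hr.le]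

/-- Second order upper bound for `r ^ α` around `1`, for exponents at least `2`. -/
theorem rpow_le_quadratic_of_two_le {α r : ℝ} (h2 : 2 ≤ α) (hr : 0 ≤ r) :
    r ^ α ≤ 1 + α * (r - 1) + α * (α - 1) / 2 * (r - 1) ^ 2 * max 1 r ^ (α - 2) := by
  have bern : ∀ x : ℝ, 0 ≤ x → 1 + (α - 1) * (x - 1) ≤ x ^ (α - 1) := fun x hx => by
    have h := one_add_mul_self_le_rpow_one_add (s := x - 1) (by linarith) (p := α - 1)
      (by linarith)
    rwa [add_sub_cancel] at h
  have hα : 0 < α := by linarith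
  rcases le_total r 1 with h | h
  · rw [max_eq_left h, Real.one_rpow, mul_one]
    have hd : ∀ x : ℝ, HasDerivAt (fun x => 1 + α * (x - 1) + α * (α - 1) / 2 * (x - 1) ^ 2 - x ^ α)
        (α * (1 + (α - 1) * (x - 1) - x ^ (α - 1))) x := fun x => by
      have h1 := ((hasDerivAt_id x).sub_const 1)
      have := (((h1.const_mul α).const_add 1).add ((h1.pow 2).const_mul (α * (α - 1) / 2))).sub
        (Real.hasDerivAt_rpow_const (x := x) (p := α) (Or.inr (by linarith)))
      refine this.congr_deriv ?_
      simp; ring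
    have anti : AntitoneOn (fun x => 1 + α * (x - 1) + α * (α - 1) / 2 * (x - 1) ^ 2 - x ^ α)
        (Set.Icc 0 1) := by
      refine antitoneOn_of_deriv_nonpos (convex_Icc 0 1)
        (fun x _ => (hd x).continuousAt.continuousWithinAt)
        (fun x _ => (hd x).differentiableAt.differentiableWithinAt) fun x hx => ?_
      rw [interior_Icc] at hx
      rw [(hd x).deriv]
      nlinarith [bern x hx.1.le]
    have := anti ⟨hr, h⟩ ⟨zero_le_one, le_rfl⟩ h
    simp only [sub_self, Real.one_rpow] at this
    linarith
  · rw [max_eq_right h]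
    have hd : ∀ x ∈ Set.Ici (1 : ℝ), HasDerivAt
        (fun x => 1 + α * (x - 1) + α * (α - 1) / 2 * (x - 1) ^ 2 * x ^ (α - 2) - x ^ α)
        (α * (1 + (α - 1) * (x - 1) * x ^ (α - 2) - x ^ (α - 1))
          + α * (α - 1) / 2 * (x - 1) ^ 2 * ((α - 2) * x ^ (α - 2 - 1))) x := fun x hx => by
      have hx0 : x ≠ 0 := by have : (1 : ℝ) ≤ x := hx; positivity
      have h1 := ((hasDerivAt_id x).sub_const 1)
      have := (((h1.const_mul α).const_add 1).add
        (((h1.pow 2).const_mul (α * (α - 1) / 2)).mul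
          (Real.hasDerivAt_rpow_const (x := x) (p := α - 2) (Or.inl hx0)))).sub
        (Real.hasDerivAt_rpow_const (x := x) (p := α) (Or.inr (by linarith)))
      refine this.congr_deriv ?_
      simp; ring
    have mono : MonotoneOn
        (fun x => 1 + α * (x - 1) + α * (α - 1) / 2 * (x - 1) ^ 2 * x ^ (α - 2) - x ^ α)
        (Set.Ici 1) := by
      refine monotoneOn_of_deriv_nonneg (convex_Ici 1)
        (fun x hx => (hd x hx).continuousAt.continuousWithinAt)
        (fun x hx => (hd x (interior_subset hx)).differentiableAt.differentiableWithinAt)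
        fun x hx => ?_
      have hx1 : (1 : ℝ) ≤ x := interior_subset hx
      have hx0 : 0 < x := by linarith
      rw [(hd x hx1).deriv]
      -- Bernoulli at 1/x, multiplied by x^(α-1), is the nonnegativity of the first bracket of the
      -- derivative.
      have b := bern x⁻¹ (by positivity)
      rw [Real.inv_rpow hx0.le] at b
      have e1 : x ^ (α - 1) = x * x ^ (α - 2) := by
        rw [show α - 1 = α - 2 + 1 by ring, Real.rpow_add_one hx0.ne', mul_comm]
      have hp : 0 < x ^ (α - 2) := Real.rpow_pos_of_pos hx0 _
      have b2 := mul_le_mul_of_nonneg_left b (Real.rpow_pos_of_pos hx0 (α - 1)).le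
      rw [mul_inv_cancel₀ (Real.rpow_pos_of_pos hx0 (α - 1)).ne'] at b2
      have b3 : x ^ (α - 1) * (1 + (α - 1) * (x⁻¹ - 1))
          = x ^ (α - 1) - (α - 1) * (x - 1) * x ^ (α - 2) := by
        rw [e1]; field_simp; ring
      rw [b3] at b2
      have : 0 ≤ α * (α - 1) / 2 * (x - 1) ^ 2 * ((α - 2) * x ^ (α - 2 - 1)) := by
        have := Real.rpow_pos_of_pos hx0 (α - 2 - 1)
        have : 0 ≤ α - 1 := by linarith
        have : 0 ≤ α - 2 := by linarith
        positivity
      have : 0 ≤ α * (1 + (α - 1) * (x - 1) * x ^ (α - 2) - x ^ (α - 1)) :=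
        mul_nonneg hα.le (by linarith)
      linarith
    have := mono (Set.mem_Ici.2 le_rfl) (Set.mem_Ici.2 h) h
    simp only [sub_self, Real.one_rpow] at this
    linarith

theorem exp_half_le : Real.exp (1 / 2) ≤ 1.65 := by
  have h : Real.exp (1 / 2) ^ 2 = Real.exp 1 := by rw [← Real.exp_nat_mul]; norm_num
  have := Real.exp_one_lt_d9
  nlinarith [Real.exp_pos (1 / 2)]

/-- Splitting `(1 + y) ^ γ` into a bounded part and a power of `y`. -/
theorem one_add_rpow_le {γ y : ℝ} (hγ : 1 ≤ γ) (hy : 0 ≤ y) :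
    (1 + y) ^ γ ≤ 1.65 + (1 + 2 * γ) ^ (γ - 1) * y ^ γ := by
  have h0 : 0 < 1 + 2 * γ := by linarith
  -- 1 + y is a convex combination of 1 + 1/(2γ) and (1+2γ)y. The first point contributes (1 +
  -- 1/(2γ))^(γ-1) ≤ e^(1/2) < 1.65.
  have key := (convexOn_rpow hγ).2
    (Set.mem_Ici.2 (by positivity : 0 ≤ (1 + 2 * γ) / (2 * γ)))
    (Set.mem_Ici.2 (by positivity : 0 ≤ (1 + 2 * γ) * y))
    (by positivity : 0 ≤ 2 * γ / (1 + 2 * γ)) (by positivity : 0 ≤ 1 / (1 + 2 * γ))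
    (by field_simp; ring)
  simp only [smul_eq_mul] at key
  have e : 2 * γ / (1 + 2 * γ) * ((1 + 2 * γ) / (2 * γ)) + 1 / (1 + 2 * γ) * ((1 + 2 * γ) * y)
      = 1 + y := by field_simp
  rw [e] at key
  refine key.trans (add_le_add ?_ ?_)
  · have e2 : 2 * γ / (1 + 2 * γ) * ((1 + 2 * γ) / (2 * γ)) ^ γ
        = ((1 + 2 * γ) / (2 * γ)) ^ (γ - 1) := by
      rw [Real.rpow_sub_one (by positivity)]; field_simp
    rw [e2]
    refine le_trans ?_ exp_half_le
    have h1 : (1 + 2 * γ) / (2 * γ) ≤ Real.exp (1 / (2 * γ)) := by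
      have := Real.add_one_le_exp (1 / (2 * γ))
      refine le_trans (le_of_eq ?_) this
      field_simp
    refine (Real.rpow_le_rpow (by positivity) h1 (by linarith)).trans ?_
    rw [← Real.exp_mul]
    refine Real.exp_le_exp.2 ?_
    rw [div_mul_eq_mul_div, one_mul, div_le_div_iff₀ (by positivity) (by norm_num)]
    linarith
  · rw [Real.mul_rpow h0.le hy, Real.rpow_sub_one h0.ne']
    apply le_of_eq; field_simp

/-- By convexity `exp` lies below its chord over [0, 2/3], and e^(2/3) ≤ 2 since log 2 ≥ 2/3. -/
theorem exp_le_one_add_mul {u : ℝ} (hu0 : 0 ≤ u) (hu : u ≤ 2 / 3) :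
    Real.exp u ≤ 1 + 3 / 2 * u := by
  have h2 : Real.exp (2 / 3) ≤ 2 := by
    rw [← Real.le_log_iff_exp_le (by norm_num)]
    have := Real.log_two_gt_d9
    linarith
  have hc := convexOn_exp.2 (Set.mem_univ (0 : ℝ)) (Set.mem_univ (2 / 3 : ℝ))
    (by linarith : 0 ≤ 1 - 3 / 2 * u) (by linarith : 0 ≤ 3 / 2 * u) (by ring)
  simp only [smul_eq_mul, mul_zero, zero_add, Real.exp_zero, mul_one] at hc
  rw [show 3 / 2 * u * (2 / 3) = u by ring] at hc
  nlinarith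

theorem div_one_add_le {u : ℝ} (hu0 : 0 < u) (hu : u ≤ 2 / 3) : u / (1 + u) ≤ 2 / 5 := by
  rw [div_le_div_iff₀ (by linarith) (by norm_num)]; linarith

/-- The contribution of the tail of the likelihood ratio is of the order of the variance. -/
theorem tail_term_le {γ u q : ℝ} (hγ : 1 ≤ γ) (hu0 : 0 < u) (hu : u ≤ 2 / 3) (hq0 : 0 < q)
    (hq : q ≤ 0.06) (hqe : q ≤ Real.exp (-(γ + 1)) * (u / (1 + u))) :
    (1 + 2 * γ) ^ (γ - 1) * (q / (1 - q)) ^ γ * Real.exp ((γ + 1) * (γ + 2) / 2 * u)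
      ≤ 1.064 * u := by
  have hg : 0 ≤ γ - 1 := by linarith
  have hv0 : 0 < u / (1 + u) := by positivity
  -- 1/(1 - 0.06) < 1.064.
  have h1 : q / (1 - q) ≤ 1.064 * (Real.exp (-(γ + 1)) * (u / (1 + u))) := by
    rw [div_le_iff₀ (by linarith)]
    nlinarith
  have h2 : (q / (1 - q)) ^ γ ≤ 1.064 ^ γ * (Real.exp (-(γ + 1) * γ) * (u / (1 + u)) ^ γ) := by
    have hpos : 0 ≤ q / (1 - q) := div_nonneg hq0.le (by linarith)
    refine (Real.rpow_le_rpow hpos h1 (by linarith)).trans (le_of_eq ?_)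
    rw [Real.mul_rpow (by norm_num) (by positivity), Real.mul_rpow (by positivity) hv0.le,
      ← Real.exp_mul]
  -- One factor supplies the required u; the other γ - 1 factors are bounded by 2/5 and absorb
  -- (1+2γ)^(γ-1) in `h5`.
  have h3 : (u / (1 + u)) ^ γ ≤ u * (2 / 5) ^ (γ - 1) := by
    have e : (u / (1 + u)) ^ γ = u / (1 + u) * (u / (1 + u)) ^ (γ - 1) := by
      rw [Real.rpow_sub_one hv0.ne']; field_simp
    rw [e]
    refine mul_le_mul ?_ (Real.rpow_le_rpow hv0.le (div_one_add_le hu0 hu) hg) (by positivity) hu0.le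
    rw [div_le_iff₀ (by linarith)]; nlinarith
  have h4 : (1.064 : ℝ) ^ γ ≤ 1.064 * Real.exp (0.064 * (γ - 1)) := by
    have e : (1.064 : ℝ) ^ γ = 1.064 * 1.064 ^ (γ - 1) := by
      rw [Real.rpow_sub_one (by norm_num)]; field_simp
    rw [e, Real.exp_mul]
    gcongr
    have := Real.add_one_le_exp 0.064
    linarith
  have h5 : (1 + 2 * γ) ^ (γ - 1) * (2 / 5) ^ (γ - 1) ≤ Real.exp (γ / 2 * (γ - 1)) := by
    rw [← Real.mul_rpow (by linarith) (by norm_num), Real.exp_mul]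
    refine Real.rpow_le_rpow (by positivity) ?_ hg
    have a1 : Real.exp (γ / 2) = Real.exp (1 / 2) * Real.exp ((γ - 1) / 2) := by
      rw [← Real.exp_add]; ring_nf
    have a2 := Real.add_one_le_exp ((γ - 1) / 2)
    have a3 : (1.6 : ℝ) ≤ Real.exp (1 / 2) := by
      have h : Real.exp (1 / 2) ^ 2 = Real.exp 1 := by rw [← Real.exp_nat_mul]; norm_num
      have := Real.exp_one_gt_d9
      nlinarith [Real.exp_pos (1 / 2)]
    rw [a1]
    nlinarith
  have h6 : Real.exp ((γ + 1) * (γ + 2) / 2 * u) ≤ Real.exp ((γ + 1) * (γ + 2) / 3) := by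
    refine Real.exp_le_exp.2 ?_
    nlinarith [mul_nonneg (by linarith : 0 ≤ γ + 1) (by linarith : 0 ≤ γ + 2)]
  have h7 : (1 + 2 * γ) ^ (γ - 1) * (q / (1 - q)) ^ γ * Real.exp ((γ + 1) * (γ + 2) / 2 * u)
      ≤ (1 + 2 * γ) ^ (γ - 1) * ((1.064 * Real.exp (0.064 * (γ - 1))) *
        (Real.exp (-(γ + 1) * γ) * (u * (2 / 5) ^ (γ - 1)))) * Real.exp ((γ + 1) * (γ + 2) / 3) := by
    gcongr
    refine h2.trans ?_
    gcongr
  refine h7.trans ?_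
  calc _ = 1.064 * u * (((1 + 2 * γ) ^ (γ - 1) * (2 / 5) ^ (γ - 1)) * (Real.exp (0.064 * (γ - 1)) *
        Real.exp (-(γ + 1) * γ) * Real.exp ((γ + 1) * (γ + 2) / 3))) := by ring
    _ ≤ 1.064 * u * (Real.exp (γ / 2 * (γ - 1)) * (Real.exp (0.064 * (γ - 1)) *
        Real.exp (-(γ + 1) * γ) * Real.exp ((γ + 1) * (γ + 2) / 3))) := by gcongr
    _ ≤ 1.064 * u * 1 := by
        gcongr
        -- The total exponent is -γ²/6 - 0.436γ + 2/3 - 0.064, which decreases for γ ≥ 1 and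
        -- vanishes at γ = 1.
        rw [← Real.exp_add, ← Real.exp_add, ← Real.exp_add, Real.exp_le_one_iff]
        nlinarith
    _ = _ := mul_one _

end RealInequalities

/-! ### Shifts of the standard Gaussian law and their moments. -/

section Gaussian
open scoped ENNReal RealInnerProductSpace

theorem gaussianReal_map_add_eq_withDensity (b : ℝ) :
    (gaussianReal 0 1).map (· + b)
      = (gaussianReal 0 1).withDensity (fun x => ENNReal.ofReal (Real.exp (b * x - b ^ 2 / 2))) := by
  rw [gaussianReal_map_add_const, gaussianReal_of_var_ne_zero _ one_ne_zero,
    gaussianReal_of_var_ne_zero _ one_ne_zero,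
    ← withDensity_mul _ (measurable_gaussianPDF _ _) (by fun_prop)]
  congr 1
  ext x
  simp only [gaussianPDF, Pi.mul_apply]
  rw [← ENNReal.ofReal_mul (gaussianPDFReal_nonneg _ _ _)]
  congr 1
  simp only [gaussianPDFReal, NNReal.coe_one, mul_assoc, ← Real.exp_add]
  congr 2
  ring_nf

/-- It suffices to compare boxes, where the indicator times the product density factorises over
independent coordinates. -/
theorem pi_withDensity {ι : Type*} [Fintype ι] {X : ι → Type*} [∀ i, MeasurableSpace (X i)]
    (μ : ∀ i, Measure (X i)) [∀ i, IsProbabilityMeasure (μ i)] (g : ∀ i, X i → ℝ≥0∞)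
    (hg : ∀ i, Measurable (g i)) [∀ i, SigmaFinite ((μ i).withDensity (g i))] :
    Measure.pi (fun i => (μ i).withDensity (g i))
      = (Measure.pi μ).withDensity (fun x => ∏ i, g i (x i)) := by
  classical
  refine Measure.pi_eq fun s hs => ?_
  have hm : ∀ i, Measurable ((s i).indicator (g i)) := fun i => (hg i).indicator (hs i)
  have h := lintegral_prod_eq_prod_lintegral_of_indepFun Finset.univ
    (fun i (x : ∀ i, X i) => (s i).indicator (g i) (x i))
    (iIndepFun_pi (μ := μ) fun i => (hm i).aemeasurable)
    (fun i => (hm i).comp (measurable_pi_apply i))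
  rw [withDensity_apply _ (MeasurableSet.univ_pi hs), ← lintegral_indicator (MeasurableSet.univ_pi hs)]
  have e : (Set.univ.pi s).indicator (fun x : ∀ i, X i => ∏ i, g i (x i))
      = fun x => ∏ i, (s i).indicator (g i) (x i) := by
    ext x
    by_cases hx : x ∈ Set.univ.pi s
    · rw [Set.indicator_of_mem hx]
      exact Finset.prod_congr rfl fun i _ => (Set.indicator_of_mem (hx i trivial) _).symm
    · rw [Set.indicator_of_notMem hx]
      simp only [Set.mem_pi, Set.mem_univ, true_imp_iff, not_forall] at hx
      obtain ⟨i, hi⟩ := hx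
      exact (Finset.prod_eq_zero (Finset.mem_univ i) (Set.indicator_of_notMem hi _)).symm
  rw [e, h]
  refine Finset.prod_congr rfl fun i _ => ?_
  rw [withDensity_apply _ (hs i), ← lintegral_indicator (hs i),
    ← (measurePreserving_eval μ i).lintegral_comp (hm i)]

variable {n : ℕ}

/-- The density of the standard Gaussian law translated by `b` with respect to the standard
Gaussian law. -/
noncomputable def gaussianShift (b z : EuclideanSpace ℝ (Fin n)) : ℝ :=
  Real.exp (⟪b, z⟫ - ‖b‖ ^ 2 / 2)

theorem gaussianShift_pos (b z : EuclideanSpace ℝ (Fin n)) : 0 < gaussianShift b z :=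
  Real.exp_pos _

@[fun_prop]
theorem measurable_gaussianShift (b : EuclideanSpace ℝ (Fin n)) : Measurable (gaussianShift b) := by
  unfold gaussianShift; fun_prop

/-- Coordinates are independent, so the one-dimensional densities multiply and their exponents add
up to ⟪b, z⟫ - ‖b‖²/2. -/
theorem stdGaussian_map_add (b : EuclideanSpace ℝ (Fin n)) :
    (stdGaussian (EuclideanSpace ℝ (Fin n))).map (· + b)
      = (stdGaussian _).withDensity (fun z => ENNReal.ofReal (gaussianShift b z)) := by
  have hg : ∀ i, Measurable fun x => ENNReal.ofReal (Real.exp (b i * x - b i ^ 2 / 2)) := by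
    fun_prop
  have hpr : ∀ i, IsProbabilityMeasure ((gaussianReal 0 1).map (· + b i)) := fun i =>
    Measure.isProbabilityMeasure_map (by fun_prop)
  have hpr' : ∀ i, IsProbabilityMeasure ((gaussianReal 0 1).withDensity
      (fun x => ENNReal.ofReal (Real.exp (b i * x - b i ^ 2 / 2)))) := fun i => by
    rw [← gaussianReal_map_add_eq_withDensity]; exact hpr i
  have h1 := Measure.pi_map_pi (μ := fun _ : Fin n => gaussianReal 0 1)
    (f := fun i x => x + b i) (fun i => by fun_prop)
  simp only [gaussianReal_map_add_eq_withDensity] at h1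
  rw [pi_withDensity _ _ hg] at h1
  have hL : Measurable (WithLp.toLp 2 : (Fin n → ℝ) → EuclideanSpace ℝ (Fin n)) := by fun_prop
  ext s hs
  rw [← map_pi_eq_stdGaussian, Measure.map_map (by fun_prop) hL,
    Measure.map_apply (by fun_prop) hs, withDensity_apply _ hs,
    setLIntegral_map hs (by fun_prop) hL]
  have e : ((· + b) ∘ WithLp.toLp 2 : (Fin n → ℝ) → EuclideanSpace ℝ (Fin n))
      = WithLp.toLp 2 ∘ fun x i => x i + b i := by
    ext x i; simp
  rw [e, Set.preimage_comp, ← Measure.map_apply (by fun_prop) (hL hs), h1,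
    withDensity_apply _ (hL hs)]
  refine setLIntegral_congr_fun (hL hs) fun x _ => ?_
  simp only [gaussianShift]
  rw [← ENNReal.ofReal_prod_of_nonneg (fun i _ => (Real.exp_pos _).le), ← Real.exp_sum]
  congr 2
  rw [Finset.sum_sub_distrib, EuclideanSpace.real_norm_sq_eq, Finset.sum_div]
  congr 1
  simp [PiLp.inner_apply, mul_comm]

theorem lintegral_stdGaussian_add (b : EuclideanSpace ℝ (Fin n))
    {F : EuclideanSpace ℝ (Fin n) → ℝ≥0∞} (hF : Measurable F) :
    ∫⁻ z, F (z + b) ∂stdGaussian _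
      = ∫⁻ z, ENNReal.ofReal (gaussianShift b z) * F z ∂stdGaussian _ := by
  rw [← lintegral_map hF (by fun_prop : Measurable (· + b)), stdGaussian_map_add,
    lintegral_withDensity_eq_lintegral_mul _ (by fun_prop) hF]
  rfl

theorem lintegral_gaussianShift (b : EuclideanSpace ℝ (Fin n)) :
    ∫⁻ z, ENNReal.ofReal (gaussianShift b z) ∂stdGaussian _ = 1 := by
  have := lintegral_stdGaussian_add b (F := fun _ => 1) measurable_const
  simpa using this.symm

theorem integrable_gaussianShift (b : EuclideanSpace ℝ (Fin n)) :
    Integrable (gaussianShift b) (stdGaussian _) := by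
  refine ⟨(measurable_gaussianShift b).aestronglyMeasurable, ?_⟩
  rw [hasFiniteIntegral_iff_ofReal (ae_of_all _ fun z => (gaussianShift_pos b z).le),
    lintegral_gaussianShift]
  exact ENNReal.one_lt_top

theorem integral_gaussianShift (b : EuclideanSpace ℝ (Fin n)) :
    ∫ z, gaussianShift b z ∂stdGaussian _ = 1 := by
  rw [integral_eq_lintegral_of_nonneg_ae (ae_of_all _ fun z => (gaussianShift_pos b z).le)
    (measurable_gaussianShift b).aestronglyMeasurable, lintegral_gaussianShift, ENNReal.toReal_one]

/-- Products of powers of shift densities are multiples of shift densities. -/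
theorem gaussianShift_rpow_mul_rpow (b c z : EuclideanSpace ℝ (Fin n)) (s t : ℝ) :
    gaussianShift b z ^ s * gaussianShift c z ^ t
      = Real.exp (s * (s - 1) / 2 * ‖b‖ ^ 2 + t * (t - 1) / 2 * ‖c‖ ^ 2 + s * t * ⟪b, c⟫)
        * gaussianShift (s • b + t • c) z := by
  simp only [gaussianShift]
  rw [← Real.exp_mul, ← Real.exp_mul, ← Real.exp_add, ← Real.exp_add]
  congr 1
  rw [inner_add_left, real_inner_smul_left, real_inner_smul_left, norm_add_sq_real, norm_smul,
    norm_smul, real_inner_smul_left, real_inner_smul_right, mul_pow, mul_pow, Real.norm_eq_abs,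
    Real.norm_eq_abs, sq_abs, sq_abs]
  ring

theorem integrable_gaussianShift_rpow_mul_rpow (b c : EuclideanSpace ℝ (Fin n)) (s t : ℝ) :
    Integrable (fun z => gaussianShift b z ^ s * gaussianShift c z ^ t) (stdGaussian _) := by
  simp only [gaussianShift_rpow_mul_rpow]
  exact (integrable_gaussianShift _).const_mul _

theorem integral_gaussianShift_rpow_mul_rpow (b c : EuclideanSpace ℝ (Fin n)) (s t : ℝ) :
    ∫ z, gaussianShift b z ^ s * gaussianShift c z ^ t ∂stdGaussian _
      = Real.exp (s * (s - 1) / 2 * ‖b‖ ^ 2 + t * (t - 1) / 2 * ‖c‖ ^ 2 + s * t * ⟪b, c⟫) := by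
  simp only [gaussianShift_rpow_mul_rpow]
  rw [integral_const_mul, integral_gaussianShift, mul_one]

end Gaussian

/-! ### The Rényi moment of two Gaussian mixtures with a common component. -/

section MixtureMoment
open scoped ENNReal RealInnerProductSpace

/-- Pointwise bound for the Rényi integrand of two mixtures with a common component, for orders at
most `2`. -/
theorem mixture_ratio_rpow_le_of_le_two {α q l m : ℝ} (h1 : 1 ≤ α) (h2 : α ≤ 2) (hq0 : 0 < q)
    (hq1 : q < 1) (hl : 0 < l) (hm : 0 < m) :
    ((1 - q + q * l) / (1 - q + q * m)) ^ α * (1 - q + q * m)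
      ≤ (1 - q + q * m) + α * (q * (l - m)) + (α - 1) * (q ^ 2 / (1 - q)) * (l - m) ^ 2 := by
  have hp : 0 < 1 - q := by linarith
  have hw : 0 < 1 - q + q * m := by positivity
  have h := rpow_le_quadratic_of_le_two h1 h2
    (by positivity : 0 ≤ (1 - q + q * l) / (1 - q + q * m))
  -- With w the denominator, w(r - 1) = q(l - m), so the linear term is free of w and has mean zero;
  -- the quadratic one is divided by w ≥ 1 - q, the weight of the common component.
  have e : (1 - q + q * l) / (1 - q + q * m) - 1 = q * (l - m) / (1 - q + q * m) := by
    field_simp; ring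
  rw [e] at h
  have h' := mul_le_mul_of_nonneg_right h hw.le
  refine h'.trans ?_
  have e2 : (1 + α * (q * (l - m) / (1 - q + q * m))
      + (α - 1) * (q * (l - m) / (1 - q + q * m)) ^ 2) * (1 - q + q * m)
      = (1 - q + q * m) + α * (q * (l - m))
        + (α - 1) * (q ^ 2 / (1 - q + q * m)) * (l - m) ^ 2 := by
    field_simp
  rw [e2]
  have : 0 ≤ α - 1 := by linarith
  gcongr
  nlinarith

/-- Pointwise bound for the Rényi integrand of two mixtures with a common component, for orders at
least `2`. -/
theorem mixture_ratio_rpow_le_of_two_le {α γ q l m : ℝ} (h2 : 2 ≤ α) (hγ1 : 1 ≤ γ)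
    (hγ : α - 2 ≤ γ) (hq0 : 0 < q) (hq1 : q < 1) (hl : 0 < l) (hm : 0 < m) :
    ((1 - q + q * l) / (1 - q + q * m)) ^ α * (1 - q + q * m)
      ≤ (1 - q + q * m) + α * (q * (l - m)) + α * (α - 1) / 2 * (q ^ 2 / (1 - q)) *
        (1.65 * (l - m) ^ 2 + (1 + 2 * γ) ^ (γ - 1) * (q / (1 - q)) ^ γ *
          (l ^ (γ + 2) + l ^ γ * m ^ (2 : ℝ))) := by
  have hp : 0 < 1 - q := by linarith
  have hw : 0 < 1 - q + q * m := by positivity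
  have hα : 0 ≤ α * (α - 1) / 2 := by nlinarith
  have h := rpow_le_quadratic_of_two_le h2
    (by positivity : 0 ≤ (1 - q + q * l) / (1 - q + q * m))
  have e : (1 - q + q * l) / (1 - q + q * m) - 1 = q * (l - m) / (1 - q + q * m) := by
    field_simp; ring
  -- Dropping q * m from the denominator bounds the ratio by a function of l alone, whose moments
  -- are explicit.
  have hr : max 1 ((1 - q + q * l) / (1 - q + q * m)) ≤ 1 + q / (1 - q) * l := by
    refine max_le (by have : 0 ≤ q / (1 - q) * l := by positivity
                      linarith) ?_
    rw [div_le_iff₀ hw]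
    have e3 : (1 + q / (1 - q) * l) * (1 - q + q * m)
        = 1 - q + q * l + (q * m + q / (1 - q) * l * (q * m)) := by field_simp
    rw [e3]
    have : 0 ≤ q * m + q / (1 - q) * l * (q * m) := by positivity
    linarith
  have hmax : max 1 ((1 - q + q * l) / (1 - q + q * m)) ^ (α - 2)
      ≤ 1.65 + (1 + 2 * γ) ^ (γ - 1) * ((q / (1 - q)) ^ γ * l ^ γ) := by
    rw [← Real.mul_rpow (by positivity) hl.le]
    have hone : 1 ≤ max 1 ((1 - q + q * l) / (1 - q + q * m)) := le_max_left _ _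
    exact ((Real.rpow_le_rpow_of_exponent_le hone hγ).trans
      (Real.rpow_le_rpow (by linarith) hr (by linarith))).trans
        (one_add_rpow_le hγ1 (by positivity))
  rw [e] at h
  refine (mul_le_mul_of_nonneg_right h hw.le).trans ?_
  set X := max 1 ((1 - q + q * l) / (1 - q + q * m)) ^ (α - 2) with hX
  have hX0 : 0 ≤ X := Real.rpow_nonneg (zero_le_one.trans (le_max_left _ _)) _
  have e2 : (1 + α * (q * (l - m) / (1 - q + q * m))
      + α * (α - 1) / 2 * (q * (l - m) / (1 - q + q * m)) ^ 2 * X) * (1 - q + q * m)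
      = (1 - q + q * m) + α * (q * (l - m))
        + α * (α - 1) / 2 * (q ^ 2 / (1 - q + q * m)) * ((l - m) ^ 2 * X) := by
    field_simp
  rw [e2]
  have hC : 0 ≤ (1 + 2 * γ) ^ (γ - 1) * (q / (1 - q)) ^ γ := by positivity
  have e4 : l ^ (γ + 2) = l ^ γ * l ^ 2 := by
    rw [Real.rpow_add hl]; norm_num
  have e5 : m ^ (2 : ℝ) = m ^ 2 := by norm_num
  have hlg : 0 < l ^ γ := Real.rpow_pos_of_pos hl _
  gcongr
  · nlinarith
  · refine (mul_le_mul_of_nonneg_left hmax (sq_nonneg _)).trans ?_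
    rw [e4, e5]
    have : (1 + 2 * γ) ^ (γ - 1) * (q / (1 - q)) ^ γ * l ^ γ * (l - m) ^ 2
        ≤ (1 + 2 * γ) ^ (γ - 1) * (q / (1 - q)) ^ γ * l ^ γ * (l ^ 2 + m ^ 2) := by
      gcongr
      nlinarith [mul_pos hl hm]
    linarith

variable {n : ℕ} {b c : EuclideanSpace ℝ (Fin n)} {u q α : ℝ}

theorem integrable_sq_gaussianShift_sub (b c : EuclideanSpace ℝ (Fin n)) :
    Integrable (fun z => (gaussianShift b z - gaussianShift c z) ^ 2) (stdGaussian _) := by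
  have h := ((integrable_gaussianShift_rpow_mul_rpow b c 2 0).add
    (integrable_gaussianShift_rpow_mul_rpow b c 0 2)).sub
      ((integrable_gaussianShift_rpow_mul_rpow b c 1 1).const_mul 2)
  refine h.congr (ae_of_all _ fun z => ?_)
  simp; ring

/-- The integral is e^(‖b‖²) + e^(‖c‖²) - 2e^⟪b,c⟫. The bound on ‖b - c‖ gives ⟪b,c⟫ ≥ -u/2, so the
total is at most 2(1 + 3u/2) - 2(1 - u/2) = 4u. -/
theorem integral_sq_gaussianShift_sub_le (hu0 : 0 ≤ u) (hu : u ≤ 2 / 3) (hb : ‖b‖ ^ 2 ≤ u)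
    (hc : ‖c‖ ^ 2 ≤ u) (hbc : ‖b - c‖ ^ 2 ≤ u) :
    ∫ z, (gaussianShift b z - gaussianShift c z) ^ 2 ∂stdGaussian _ ≤ 4 * u := by
  have i1 := integrable_gaussianShift_rpow_mul_rpow b c 2 0
  have i2 := integrable_gaussianShift_rpow_mul_rpow b c 0 2
  have i3 := (integrable_gaussianShift_rpow_mul_rpow b c 1 1).const_mul 2
  have e : (fun z => (gaussianShift b z - gaussianShift c z) ^ 2) = fun z =>
      gaussianShift b z ^ (2 : ℝ) * gaussianShift c z ^ (0 : ℝ)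
        + gaussianShift b z ^ (0 : ℝ) * gaussianShift c z ^ (2 : ℝ)
        - 2 * (gaussianShift b z ^ (1 : ℝ) * gaussianShift c z ^ (1 : ℝ)) := by
    ext z; simp; ring
  rw [e, integral_sub (i1.fun_add i2) i3, integral_add i1 i2, integral_const_mul,
    integral_gaussianShift_rpow_mul_rpow, integral_gaussianShift_rpow_mul_rpow,
    integral_gaussianShift_rpow_mul_rpow]
  have hin : -(u / 2) ≤ ⟪b, c⟫ := by
    rw [norm_sub_sq_real] at hbc
    nlinarith [sq_nonneg ‖b‖, sq_nonneg ‖c‖]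
  have h1 : Real.exp (‖b‖ ^ 2) ≤ 1 + 3 / 2 * u :=
    (Real.exp_le_exp.2 hb).trans (exp_le_one_add_mul hu0 hu)
  have h2 : Real.exp (‖c‖ ^ 2) ≤ 1 + 3 / 2 * u :=
    (Real.exp_le_exp.2 hc).trans (exp_le_one_add_mul hu0 hu)
  have h3 : 1 - u / 2 ≤ Real.exp ⟪b, c⟫ := by
    have := Real.add_one_le_exp ⟪b, c⟫
    linarith
  norm_num
  linarith

theorem inner_le_of_sq_le (hb : ‖b‖ ^ 2 ≤ u) (hc : ‖c‖ ^ 2 ≤ u) : ⟪b, c⟫ ≤ u := by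
  have := real_inner_le_norm b c
  nlinarith [sq_nonneg (‖b‖ - ‖c‖)]

theorem integrable_mixture_linear (b c : EuclideanSpace ℝ (Fin n)) (q α : ℝ) :
    Integrable (fun z => (1 - q + q * gaussianShift c z)
      + α * (q * (gaussianShift b z - gaussianShift c z))) (stdGaussian _) :=
  ((integrable_const _).add ((integrable_gaussianShift c).const_mul q)).add
    ((((integrable_gaussianShift b).sub (integrable_gaussianShift c)).const_mul q).const_mul α)

theorem integral_mixture_linear (b c : EuclideanSpace ℝ (Fin n)) (q α : ℝ) :
    ∫ z, (1 - q + q * gaussianShift c z)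
      + α * (q * (gaussianShift b z - gaussianShift c z)) ∂stdGaussian _ = 1 := by
  have h1 := (integrable_gaussianShift c).const_mul q
  have h2 : Integrable (fun z => q * (gaussianShift b z - gaussianShift c z)) (stdGaussian _) :=
    ((integrable_gaussianShift b).sub (integrable_gaussianShift c)).const_mul q
  rw [integral_add ((integrable_const _).fun_add h1) (h2.const_mul α),
    integral_add (integrable_const _) h1, integral_const_mul, integral_const_mul,
    integral_const_mul, integral_sub (integrable_gaussianShift b) (integrable_gaussianShift c),
    integral_gaussianShift, integral_gaussianShift]
  simp

theorem lintegral_ofReal_le_of_le_integrable {X : Type*} [MeasurableSpace X] {μ : Measure X}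
    {f g : X → ℝ} (hg : Integrable g μ) (hf0 : ∀ x, 0 ≤ f x) (hfg : ∀ x, f x ≤ g x) {C : ℝ}
    (hC : ∫ x, g x ∂μ ≤ C) : ∫⁻ x, ENNReal.ofReal (f x) ∂μ ≤ ENNReal.ofReal C := by
  refine (lintegral_mono fun x => ENNReal.ofReal_le_ofReal (hfg x)).trans ?_
  rw [← ofReal_integral_eq_lintegral_ofReal hg (ae_of_all _ fun x => (hf0 x).trans (hfg x))]
  exact ENNReal.ofReal_le_ofReal hC

/-- The Rényi moment of the subsampled Gaussian mechanism: two mixtures of unit Gaussian laws which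
share the component of weight `1 - q`, and whose components are at squared distances at most `u`. -/
theorem lintegral_mixture_ratio_rpow_le (hu0 : 0 < u) (hu : u ≤ 2 / 3) (hb : ‖b‖ ^ 2 ≤ u)
    (hc : ‖c‖ ^ 2 ≤ u) (hbc : ‖b - c‖ ^ 2 ≤ u) (hα : 1 ≤ α) (hq0 : 0 < q)
    (hq : q ≤ Real.exp (-α) * (u / (1 + u))) :
    ∫⁻ z, ENNReal.ofReal (((1 - q + q * gaussianShift b z) / (1 - q + q * gaussianShift c z)) ^ α
        * (1 - q + q * gaussianShift c z)) ∂stdGaussian _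
      ≤ ENNReal.ofReal (1 + 5 * α * (α - 1) * q ^ 2 * u) := by
  have hv := div_one_add_le hu0 hu
  have hv0 : 0 ≤ u / (1 + u) := by positivity
  have he1 : Real.exp (-1) ≤ 0.37 := by
    rw [Real.exp_neg]
    have := Real.exp_one_gt_d9
    rw [inv_le_comm₀ (Real.exp_pos 1) (by norm_num)]
    norm_num; linarith
  have hq1 : q ≤ 0.2 := by
    have : Real.exp (-α) ≤ Real.exp (-1) := Real.exp_le_exp.2 (by linarith)
    nlinarith [Real.exp_pos (-α)]
  have hp : 0 < 1 - q := by linarith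
  have hchi := integral_sq_gaussianShift_sub_le hu0.le hu hb hc hbc
  have hf0 : ∀ z, 0 ≤ ((1 - q + q * gaussianShift b z) / (1 - q + q * gaussianShift c z)) ^ α
        * (1 - q + q * gaussianShift c z) := fun z => by
    have := gaussianShift_pos b z
    have := gaussianShift_pos c z
    positivity
  rcases le_total α 2 with h2 | h2
  · refine lintegral_ofReal_le_of_le_integrable ((integrable_mixture_linear b c q α).add
      ((integrable_sq_gaussianShift_sub b c).const_mul ((α - 1) * (q ^ 2 / (1 - q))))) hf0
      (fun z => mixture_ratio_rpow_le_of_le_two hα h2 hq0 (by linarith) (gaussianShift_pos b z)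
        (gaussianShift_pos c z)) ?_
    simp only [Pi.add_apply]
    rw [integral_add (integrable_mixture_linear b c q α)
      ((integrable_sq_gaussianShift_sub b c).const_mul _), integral_mixture_linear,
      integral_const_mul]
    -- 5/4 times the 4u of the squared difference is the constant 5; the factor α ≥ 1 is to spare.
    have h3 : q ^ 2 / (1 - q) ≤ 5 / 4 * q ^ 2 := by
      rw [div_le_iff₀ hp]; nlinarith [sq_nonneg q]
    have h4 : (α - 1) * (q ^ 2 / (1 - q)) *
        ∫ z, (gaussianShift b z - gaussianShift c z) ^ 2 ∂stdGaussian (EuclideanSpace ℝ (Fin n))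
        ≤ (α - 1) * (5 / 4 * q ^ 2) * (4 * u) := by
      have : 0 ≤ α - 1 := by linarith
      gcongr
    have h5 : 0 ≤ (α - 1) * (α - 1) * q ^ 2 * u := by
      have : 0 ≤ α - 1 := by linarith
      positivity
    nlinarith
  -- The exponent α - 2 is raised to at least 1, as convexity of t ↦ t^γ requires; γ + 1 ≤ α keeps
  -- the smallness of q available.
  · set γ := max (α - 2) 1 with hγdef
    have hγ1 : 1 ≤ γ := le_max_right _ _
    have hγ : α - 2 ≤ γ := le_max_left _ _
    have hγα : γ + 1 ≤ α := by
      rw [hγdef, ← le_sub_iff_add_le]; exact max_le (by linarith) (by linarith)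
    have hqs : q ≤ 0.06 := by
      have h1 : Real.exp (-α) ≤ Real.exp (-1) * Real.exp (-1) := by
        rw [← Real.exp_add]; exact Real.exp_le_exp.2 (by linarith)
      have h2 : Real.exp (-α) ≤ 0.37 * 0.37 := h1.trans (by gcongr)
      nlinarith [Real.exp_pos (-α)]
    have htail := tail_term_le hγ1 hu0 hu hq0 hqs (hq.trans (by gcongr))
    set C := (1 + 2 * γ) ^ (γ - 1) * (q / (1 - q)) ^ γ with hCdef
    have hC0 : 0 ≤ C := by positivity
    have j1 : Integrable (fun z => gaussianShift b z ^ (γ + 2)) (stdGaussian _) := by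
      simpa using integrable_gaussianShift_rpow_mul_rpow b c (γ + 2) 0
    have j2 := integrable_gaussianShift_rpow_mul_rpow b c γ 2
    have j3 := (integrable_sq_gaussianShift_sub b c).const_mul 1.65
    have j4 := (j1.fun_add j2).const_mul C
    refine lintegral_ofReal_le_of_le_integrable ((integrable_mixture_linear b c q α).add
      ((j3.fun_add j4).const_mul (α * (α - 1) / 2 * (q ^ 2 / (1 - q))))) hf0
      (fun z => mixture_ratio_rpow_le_of_two_le h2 hγ1 hγ hq0 (by linarith)
        (gaussianShift_pos b z) (gaussianShift_pos c z)) ?_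
    have i1 : ∫ z, gaussianShift b z ^ (γ + 2) ∂stdGaussian (EuclideanSpace ℝ (Fin n))
        ≤ Real.exp ((γ + 1) * (γ + 2) / 2 * u) := by
      have := integral_gaussianShift_rpow_mul_rpow b c (γ + 2) 0
      simp only [Real.rpow_zero, mul_one] at this
      rw [this]
      refine Real.exp_le_exp.2 ?_
      have : (γ + 2) * (γ + 1) / 2 * ‖b‖ ^ 2 ≤ (γ + 2) * (γ + 1) / 2 * u := by gcongr
      linarith
    have i2 : ∫ z, gaussianShift b z ^ γ * gaussianShift c z ^ (2 : ℝ)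
        ∂stdGaussian (EuclideanSpace ℝ (Fin n)) ≤ Real.exp ((γ + 1) * (γ + 2) / 2 * u) := by
      rw [integral_gaussianShift_rpow_mul_rpow]
      refine Real.exp_le_exp.2 ?_
      have hin := inner_le_of_sq_le hb hc
      have : γ * (γ - 1) / 2 * ‖b‖ ^ 2 ≤ γ * (γ - 1) / 2 * u := by
        have : 0 ≤ γ - 1 := by linarith
        gcongr
      -- γ(γ-1)/2 + 1 + 2γ = (γ+1)(γ+2)/2, so the mixed moment has the same bound as the pure one.
      have : γ * 2 * ⟪b, c⟫ ≤ γ * 2 * u := by gcongr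
      linarith
    simp only [Pi.add_apply]
    rw [integral_add (integrable_mixture_linear b c q α) ((j3.fun_add j4).const_mul _),
      integral_mixture_linear, integral_const_mul]
    have e1 : ∫ z, (1.65 * (gaussianShift b z - gaussianShift c z) ^ 2
          + C * (gaussianShift b z ^ (γ + 2) + gaussianShift b z ^ γ * gaussianShift c z ^ (2 : ℝ)))
          ∂stdGaussian (EuclideanSpace ℝ (Fin n)) ≤ 1.65 * (4 * u) + 2 * (1.064 * u) := by
      rw [integral_add j3 j4, integral_const_mul, integral_const_mul,
        integral_add j1 j2]
      have := mul_le_mul_of_nonneg_left (add_le_add i1 i2) hC0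
      linarith
    have h3 : q ^ 2 / (1 - q) ≤ 1.064 * q ^ 2 := by
      rw [div_le_iff₀ hp]; nlinarith [sq_nonneg q]
    have hA : 0 ≤ α * (α - 1) / 2 := by nlinarith
    have h4 : α * (α - 1) / 2 * (q ^ 2 / (1 - q)) *
        ∫ z, (1.65 * (gaussianShift b z - gaussianShift c z) ^ 2
          + C * (gaussianShift b z ^ (γ + 2) + gaussianShift b z ^ γ * gaussianShift c z ^ (2 : ℝ)))
          ∂stdGaussian (EuclideanSpace ℝ (Fin n))
        ≤ α * (α - 1) / 2 * (1.064 * q ^ 2) * (1.65 * (4 * u) + 2 * (1.064 * u)) := by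
      have : 0 ≤ q ^ 2 / (1 - q) := by positivity
      refine (mul_le_mul_of_nonneg_left e1 (mul_nonneg hA this)).trans ?_
      gcongr
    -- The constant is 1.064 · (6.6 + 2.128) / 2 < 4.65 < 5.
    have h5 : 0 ≤ α * (α - 1) / 2 * q ^ 2 * u := by positivity
    nlinarith

end MixtureMoment

/-! ### From the Rényi moment to its dual form. -/

section Holder
open scoped ENNReal RealInnerProductSpace

variable {n : ℕ} {b c : EuclideanSpace ℝ (Fin n)} {u q α p : ℝ}

/-- Jensen's inequality for the concave function `t ↦ t ^ (1 / p)`. -/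
theorem lintegral_rpow_one_div_le {X : Type*} [MeasurableSpace X] (μ : Measure X)
    [IsProbabilityMeasure μ] (h : p.HolderConjugate α) {f : X → ℝ≥0∞} (hf : Measurable f) :
    ∫⁻ x, f x ^ (1 / p) ∂μ ≤ (∫⁻ x, f x ∂μ) ^ (1 / p) := by
  have := ENNReal.lintegral_mul_le_Lp_mul_Lq μ h (f := fun x => f x ^ (1 / p)) (g := fun _ => 1)
    (hf.pow_const _).aemeasurable aemeasurable_const
  simpa [← ENNReal.rpow_mul, inv_mul_cancel₀ h.ne_zero] using this

/-- Dual form of the Rényi divergence bound for Gaussian mixtures with a common component. -/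
theorem lintegral_stdGaussian_mixture_le (hpα : p.HolderConjugate α) (hu0 : 0 < u)
    (hu : u ≤ 2 / 3) (hb : ‖b‖ ^ 2 ≤ u) (hc : ‖c‖ ^ 2 ≤ u) (hbc : ‖b - c‖ ^ 2 ≤ u) (hq0 : 0 < q)
    (hq : q ≤ Real.exp (-α) * (u / (1 + u))) (hq1 : q ≤ 1)
    {F : EuclideanSpace ℝ (Fin n) → ℝ≥0∞} (hF : Measurable F) :
    ENNReal.ofReal (1 - q) * ∫⁻ z, F z ∂stdGaussian _
        + ENNReal.ofReal q * ∫⁻ z, F (z + b) ∂stdGaussian _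
      ≤ ENNReal.ofReal (1 + 5 * α * (α - 1) * q ^ 2 * u) ^ (1 / α) *
        (ENNReal.ofReal (1 - q) * ∫⁻ z, F z ^ p ∂stdGaussian _
          + ENNReal.ofReal q * ∫⁻ z, F (z + c) ^ p ∂stdGaussian _) ^ (1 / p) := by
  have hq1' : 0 ≤ 1 - q := by linarith
  have mix : ∀ (v : EuclideanSpace ℝ (Fin n)) (G : EuclideanSpace ℝ (Fin n) → ℝ≥0∞),
      Measurable G → ENNReal.ofReal (1 - q) * ∫⁻ z, G z ∂stdGaussian _
        + ENNReal.ofReal q * ∫⁻ z, G (z + v) ∂stdGaussian _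
      = ∫⁻ z, ENNReal.ofReal (1 - q + q * gaussianShift v z) * G z ∂stdGaussian _ := by
    intro v G hG
    rw [lintegral_stdGaussian_add v hG, ← lintegral_const_mul _ hG,
      ← lintegral_const_mul _ (by fun_prop), ← lintegral_add_left (by fun_prop)]
    refine lintegral_congr fun z => ?_
    have := gaussianShift_pos v z
    rw [ENNReal.ofReal_add hq1' (by positivity), ENNReal.ofReal_mul hq0.le]
    ring
  have hW : ∀ (v z : EuclideanSpace ℝ (Fin n)), 0 < 1 - q + q * gaussianShift v z := fun v z => by
    have := gaussianShift_pos v z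
    positivity
  have hp0 := hpα.pos
  have hα0 := hpα.symm.pos
  rw [mix b F hF, mix c (fun z => F z ^ p) (hF.pow_const p)]
  -- With mixture densities W_b and W_c, W_b F is split as (W_c^(1/p) F) · (W_b / W_c^(1/p)). Since
  -- α/p = α - 1, the α-th power of the second factor is the Rényi integrand.
  have hol := ENNReal.lintegral_mul_le_Lp_mul_Lq (stdGaussian (EuclideanSpace ℝ (Fin n))) hpα
    (f := fun z => ENNReal.ofReal ((1 - q + q * gaussianShift c z) ^ (1 / p)) * F z)
    (g := fun z => ENNReal.ofReal ((1 - q + q * gaussianShift b z)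
      / (1 - q + q * gaussianShift c z) ^ (1 / p))) (by fun_prop) (by fun_prop)
  have e1 : ∀ z, ((fun z => ENNReal.ofReal ((1 - q + q * gaussianShift c z) ^ (1 / p)) * F z) *
      fun z => ENNReal.ofReal ((1 - q + q * gaussianShift b z)
        / (1 - q + q * gaussianShift c z) ^ (1 / p))) z
      = ENNReal.ofReal (1 - q + q * gaussianShift b z) * F z := fun z => by
    have h1 : 0 < (1 - q + q * gaussianShift c z) ^ (1 / p) := Real.rpow_pos_of_pos (hW c z) _
    simp only [Pi.mul_apply]
    rw [mul_right_comm, ← ENNReal.ofReal_mul h1.le, mul_div_cancel₀ _ h1.ne']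
  have e2 : ∀ z, (ENNReal.ofReal ((1 - q + q * gaussianShift c z) ^ (1 / p)) * F z) ^ p
      = ENNReal.ofReal (1 - q + q * gaussianShift c z) * F z ^ p := fun z => by
    rw [ENNReal.mul_rpow_of_nonneg _ _ hp0.le,
      ENNReal.ofReal_rpow_of_nonneg (Real.rpow_nonneg (hW c z).le _) hp0.le,
      ← Real.rpow_mul (hW c z).le, one_div, inv_mul_cancel₀ hp0.ne', Real.rpow_one]
  have e3 : ∀ z, ENNReal.ofReal ((1 - q + q * gaussianShift b z)
        / (1 - q + q * gaussianShift c z) ^ (1 / p)) ^ α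
      = ENNReal.ofReal (((1 - q + q * gaussianShift b z) / (1 - q + q * gaussianShift c z)) ^ α
        * (1 - q + q * gaussianShift c z)) := fun z => by
    have h1 : 0 < (1 - q + q * gaussianShift c z) ^ (1 / p) := Real.rpow_pos_of_pos (hW c z) _
    have hα1 : 1 / p * α = α - 1 := by
      rw [one_div, ← hpα.symm.one_sub_inv]; field_simp
    rw [ENNReal.ofReal_rpow_of_nonneg (div_nonneg (hW b z).le h1.le) hα0.le,
      Real.div_rpow (hW b z).le h1.le, Real.div_rpow (hW b z).le (hW c z).le,
      ← Real.rpow_mul (hW c z).le, hα1, Real.rpow_sub_one (hW c z).ne']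
    congr 1
    have := hW c z
    field_simp
  simp only [e2, e3] at hol
  rw [lintegral_congr e1] at hol
  refine hol.trans ?_
  rw [mul_comm]
  gcongr
  exact lintegral_mixture_ratio_rpow_le hu0 hu hb hc hbc hpα.symm.lt.le hq0 hq

end Holder

namespace DPSCC
open scoped ENNReal

variable {n : ℕ}

theorem isProbabilityMeasure_gaussianNoise (n : ℕ) (σ : ℝ) :
    IsProbabilityMeasure (gaussianNoise n σ) :=
  Measure.isProbabilityMeasure_map (by fun_prop)

theorem lintegral_gaussianNoise {σ : ℝ} {F : Vec n → ℝ≥0∞} (hF : Measurable F) :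
    ∫⁻ z, F z ∂gaussianNoise n σ = ∫⁻ z, F (σ • z) ∂stdGaussian (Vec n) :=
  lintegral_map hF (by fun_prop)

/-- Centring at the common mean a and dividing by σ reduces this to unit Gaussians. -/
theorem lintegral_gaussianNoise_mixture_le {u q α p σ : ℝ} {a b c : Vec n}
    (hpα : p.HolderConjugate α) (hu0 : 0 < u)
    (hu : u ≤ 2 / 3) (hσ : 0 < σ) (hb : ‖b - a‖ ^ 2 ≤ u * σ ^ 2) (hc : ‖c - a‖ ^ 2 ≤ u * σ ^ 2)
    (hbc : ‖b - c‖ ^ 2 ≤ u * σ ^ 2) (hq0 : 0 < q)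
    (hq : q ≤ Real.exp (-α) * (u / (1 + u))) (hq1 : q ≤ 1)
    {F : Vec n → ℝ≥0∞} (hF : Measurable F) :
    ENNReal.ofReal (1 - q) * ∫⁻ z, F (a + z) ∂gaussianNoise n σ
        + ENNReal.ofReal q * ∫⁻ z, F (b + z) ∂gaussianNoise n σ
      ≤ ENNReal.ofReal (1 + 5 * α * (α - 1) * q ^ 2 * u) ^ (1 / α) *
        (ENNReal.ofReal (1 - q) * ∫⁻ z, F (a + z) ^ p ∂gaussianNoise n σ
          + ENNReal.ofReal q * ∫⁻ z, F (c + z) ^ p ∂gaussianNoise n σ) ^ (1 / p) := by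
  have hs : ∀ v : Vec n, ‖v‖ ^ 2 ≤ u * σ ^ 2 → ‖σ⁻¹ • v‖ ^ 2 ≤ u := fun v hv => by
    rw [norm_smul, mul_pow, Real.norm_eq_abs, sq_abs, inv_pow, inv_mul_le_iff₀ (by positivity)]
    linarith
  have hsh : ∀ v z : Vec n, a + σ • (z + σ⁻¹ • (v - a)) = v + σ • z := fun v z => by
    rw [smul_add, smul_inv_smul₀ hσ.ne']; abel
  have key := lintegral_stdGaussian_mixture_le hpα hu0 hu (hs _ hb) (hs _ hc)
    (by rw [← smul_sub, sub_sub_sub_cancel_right]; exact hs _ hbc) hq0 hq hq1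
    (F := fun z => F (a + σ • z)) (by fun_prop)
  simp only [hsh] at key
  rw [lintegral_gaussianNoise (by fun_prop), lintegral_gaussianNoise (by fun_prop),
    lintegral_gaussianNoise (by fun_prop), lintegral_gaussianNoise (by fun_prop)]
  exact key

end DPSCC

/-! ### Sampling batches without replacement. -/

section Subsampling
open scoped ENNReal
open Finset

variable {ι : Type*} [Fintype ι] [DecidableEq ι]

/-- Exchanging a fixed element `a` with a random element of a random subset without `a` produces
the random subsets that contain `a`. -/
theorem sum_powersetCard_mem_eq_sum_swap {M : Type*} [AddCommMonoid M] (a : ι) (m : ℕ)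
    (G : Finset ι → M) :
    ∑ S ∈ powersetCard m univ with a ∉ S, ∑ r ∈ S, G (insert a (S.erase r))
      = (Fintype.card ι - m) • ∑ S ∈ powersetCard m univ with a ∈ S, G S := by
  have h : ∀ S ∈ (powersetCard m (univ : Finset ι)).filter (a ∈ ·),
      (Fintype.card ι - m) • G S = ∑ r ∈ Sᶜ, G S := fun S hS => by
    rw [mem_filter, mem_powersetCard] at hS
    rw [sum_const, card_compl, hS.1.2]
  rw [smul_sum, sum_congr rfl h, sum_sigma', sum_sigma']
  -- The removed element r is carried along. It ranges over the complement of the new batch, which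
  -- accounts for the multiplicity `Fintype.card ι - m`.
  refine sum_bij' (fun x _ => ⟨insert a (x.1.erase x.2), x.2⟩)
    (fun x _ => ⟨insert x.2 (x.1.erase a), x.2⟩) ?_ ?_ ?_ ?_ ?_
  · rintro ⟨S, r⟩ hx
    simp only [mem_sigma, mem_filter, mem_powersetCard] at hx ⊢
    obtain ⟨⟨⟨-, hS⟩, ha⟩, hr⟩ := hx
    refine ⟨⟨⟨subset_univ _, ?_⟩, mem_insert_self _ _⟩, ?_⟩
    · rw [card_insert_of_notMem (fun h => ha (mem_of_mem_erase h)), card_erase_add_one hr, hS]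
    · rw [mem_compl, mem_insert, not_or]
      exact ⟨fun h => ha (h ▸ hr), notMem_erase _ _⟩
  · rintro ⟨S, r⟩ hx
    simp only [mem_sigma, mem_filter, mem_powersetCard, mem_compl] at hx ⊢
    obtain ⟨⟨⟨-, hS⟩, ha⟩, hr⟩ := hx
    refine ⟨⟨⟨subset_univ _, ?_⟩, ?_⟩, mem_insert_self _ _⟩
    · rw [card_insert_of_notMem (fun h => hr (mem_of_mem_erase h)), card_erase_add_one ha, hS]
    · rw [mem_insert, not_or]
      exact ⟨fun h => hr (h ▸ ha), notMem_erase _ _⟩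
  · rintro ⟨S, r⟩ hx
    simp only [mem_sigma, mem_filter] at hx
    obtain ⟨⟨-, ha⟩, hr⟩ := hx
    simp only [Sigma.mk.injEq, heq_eq_eq, and_true]
    rw [erase_insert (fun h => ha (mem_of_mem_erase h)), insert_erase hr]
  · rintro ⟨S, r⟩ hx
    simp only [mem_sigma, mem_filter, mem_compl] at hx
    obtain ⟨⟨-, ha⟩, hr⟩ := hx
    simp only [Sigma.mk.injEq, heq_eq_eq, and_true]
    rw [erase_insert (fun h => hr (mem_of_mem_erase h)), insert_erase ha]
  · rintro ⟨S, r⟩ _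
    rfl

/-- A sum over the subsets of size `m` as a sum over pairs of subsets that differ by an exchange of
one element with `a`. -/
theorem sum_powersetCard_eq_sum_swap (a : ι) {m : ℕ} (hm : 0 < m) (hm' : m < Fintype.card ι)
    (G : Finset ι → ℝ≥0∞) :
    ∑ S ∈ powersetCard m univ, G S
      = ∑ S ∈ powersetCard m univ with a ∉ S, ∑ r ∈ S,
        ((m : ℝ≥0∞)⁻¹ * G S + ((Fintype.card ι - m : ℕ) : ℝ≥0∞)⁻¹ * G (insert a (S.erase r))) := by
  have h : ∑ S ∈ powersetCard m univ with a ∉ S, ∑ _r ∈ S, G S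
      = m • ∑ S ∈ powersetCard m univ with a ∉ S, G S := by
    rw [smul_sum]
    refine sum_congr rfl fun S hS => ?_
    rw [mem_filter, mem_powersetCard] at hS
    rw [sum_const, hS.1.2]
  simp only [sum_add_distrib, ← mul_sum]
  rw [h, sum_powersetCard_mem_eq_sum_swap, nsmul_eq_mul, nsmul_eq_mul, ← mul_assoc, ← mul_assoc,
    ENNReal.inv_mul_cancel (by exact_mod_cast hm.ne') (ENNReal.natCast_ne_top _),
    ENNReal.inv_mul_cancel (by exact_mod_cast (Nat.sub_pos_of_lt hm').ne')
      (ENNReal.natCast_ne_top _), one_mul, one_mul, add_comm,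
    sum_filter_add_sum_filter_not (powersetCard m univ) (a ∈ ·) G]

end Subsampling

namespace DPSCC
open scoped ENNReal
open Finset

variable {n Q Bs : ℕ} {Ξ : Type*}

theorem lintegral_batchLaw (G : Finset (Fin Q) → ℝ≥0∞) :
    ∫⁻ S, G S ∂batchLaw Q Bs
      = ((powersetCard Bs (univ : Finset (Fin Q))).card : ℝ≥0∞)⁻¹
        * ∑ S ∈ powersetCard Bs univ, G S := by
  have e : {S : Finset (Fin Q) | S.card = Bs} = (powersetCard Bs (univ : Finset (Fin Q)) : Set _) := by
    ext S; simp
  rw [batchLaw, uniformOn, ProbabilityTheory.cond, e, lintegral_smul_measure, lintegral_finset,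
    Measure.count_apply_finset, smul_eq_mul]
  simp

theorem isProbabilityMeasure_batchLaw (h : Bs ≤ Q) : IsProbabilityMeasure (batchLaw Q Bs) := by
  refine isProbabilityMeasure_uniformOn (Set.toFinite _) ?_
  obtain ⟨S, -, hS⟩ := exists_subset_card_eq (s := (univ : Finset (Fin Q))) (n := Bs) (by simpa)
  exact ⟨S, hS⟩

/-- Weighted Jensen inequality for `t ↦ t ^ (1 / p)`. -/
theorem sum_mul_rpow_one_div_le {ι : Type*} (s : Finset ι) (w z : ι → ℝ≥0∞) (hw : ∑ i ∈ s, w i = 1)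
    {p : ℝ} (hp : 1 ≤ p) : ∑ i ∈ s, w i * z i ^ (1 / p) ≤ (∑ i ∈ s, w i * z i) ^ (1 / p) := by
  have hp0 : 0 < p := by linarith
  have h := ENNReal.rpow_arith_mean_le_arith_mean_rpow s w (fun i => z i ^ (1 / p)) hw hp
  simp only [← ENNReal.rpow_mul, one_div, inv_mul_cancel₀ hp0.ne', ENNReal.rpow_one] at h
  simp only [one_div]
  exact (ENNReal.le_rpow_inv_iff hp0).2 h

/-- Subsampling without replacement: a bound for all pairs of batches that differ by an exchange of
one sample with `a` carries over to the average over all batches. -/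
theorem batch_average_le_of_swap {m : ℕ} (hm : 0 < m) (hmQ : m < Q) (a : Fin Q) {p : ℝ} (hp : 1 ≤ p)
    (C : ℝ≥0∞) (G H : Finset (Fin Q) → ℝ≥0∞)
    (h : ∀ S r, S.card = m → a ∉ S → r ∈ S →
      ENNReal.ofReal (1 - m / Q) * G S + ENNReal.ofReal (m / Q) * G (insert a (S.erase r))
        ≤ C * (ENNReal.ofReal (1 - m / Q) * H S
          + ENNReal.ofReal (m / Q) * H (insert a (S.erase r))) ^ (1 / p)) :
    ∫⁻ S, G S ∂batchLaw Q m ≤ C * (∫⁻ S, H S ∂batchLaw Q m) ^ (1 / p) := by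
  have hm0 : (0 : ℝ) < m := by exact_mod_cast hm
  have hmQ' : (m : ℝ) < Q := by exact_mod_cast hmQ
  have hQ0 : (0 : ℝ) < Q := hm0.trans hmQ'
  -- κ is the common factor that turns the weights 1/m and 1/(Q - m) of an exchange pair into the
  -- probabilities 1 - m/Q and m/Q.
  set κ : ℝ≥0∞ := ENNReal.ofReal (Q / (m * (Q - m))) with hκ
  have hκ0 : (0 : ℝ) ≤ Q / (m * (Q - m)) := div_nonneg hQ0.le (mul_nonneg hm0.le (by linarith))
  have k1 : (m : ℝ≥0∞)⁻¹ = κ * ENNReal.ofReal (1 - m / Q) := by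
    rw [hκ, ← ENNReal.ofReal_mul hκ0, ← ENNReal.ofReal_natCast, ← ENNReal.ofReal_inv_of_pos hm0]
    congr 1
    have : (Q : ℝ) - m ≠ 0 := by linarith
    field_simp
  have k2 : ((Q - m : ℕ) : ℝ≥0∞)⁻¹ = κ * ENNReal.ofReal (m / Q) := by
    have hpos : (0 : ℝ) < Q - m := by linarith
    rw [hκ, ← ENNReal.ofReal_mul hκ0, ← ENNReal.ofReal_natCast, Nat.cast_sub hmQ.le,
      ← ENNReal.ofReal_inv_of_pos hpos]
    congr 1
    field_simp
  set N : ℝ≥0∞ := ((powersetCard m (univ : Finset (Fin Q))).card : ℝ≥0∞) with hN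
  have hN0 : N ≠ 0 := by
    rw [hN, card_powersetCard, card_univ, Fintype.card_fin]
    exact_mod_cast (Nat.choose_pos hmQ.le).ne'
  set X : Finset (Σ _ : Finset (Fin Q), Fin Q) :=
    (((powersetCard m (univ : Finset (Fin Q))).filter (a ∉ ·)).sigma fun S => S) with hX
  have avg : ∀ G' : Finset (Fin Q) → ℝ≥0∞, ∫⁻ S, G' S ∂batchLaw Q m
      = ∑ x ∈ X, N⁻¹ * κ * (ENNReal.ofReal (1 - m / Q) * G' x.1
          + ENNReal.ofReal (m / Q) * G' (insert a (x.1.erase x.2))) := by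
    intro G'
    rw [lintegral_batchLaw, sum_powersetCard_eq_sum_swap a hm (by simpa using hmQ), hX,
      sum_sigma, mul_sum]
    refine sum_congr rfl fun S _ => ?_
    rw [mul_sum]
    refine sum_congr rfl fun r _ => ?_
    rw [Fintype.card_fin, k1, k2]
    ring
  -- The averaging identity applied to the constant 1 shows that the pairs carry total mass one, as
  -- Jensen needs.
  have hw : ∑ _x ∈ X, N⁻¹ * κ = 1 := by
    have h1 := avg fun _ => 1
    have hs : ENNReal.ofReal (1 - m / Q) + ENNReal.ofReal (m / Q) = 1 := by
      rw [← ENNReal.ofReal_add (by rw [sub_nonneg, div_le_one hQ0]; exact hmQ'.le) (by positivity)]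
      simp
    have := isProbabilityMeasure_batchLaw hmQ.le
    simp only [mul_one, hs, lintegral_const, measure_univ] at h1
    exact h1.symm
  rw [avg G, avg H]
  refine le_trans (sum_le_sum fun x hx => ?_)
    ((mul_sum _ _ _).symm.le.trans (mul_le_mul_right (sum_mul_rpow_one_div_le X (fun _ => N⁻¹ * κ)
      (fun x => ENNReal.ofReal (1 - m / Q) * H x.1
          + ENNReal.ofReal (m / Q) * H (insert a (x.1.erase x.2))) hw hp) C))
  simp only [hX, mem_sigma, mem_filter, mem_powersetCard] at hx
  rw [mul_left_comm]
  exact mul_le_mul_right (h x.1 x.2 hx.1.1.2 hx.1.2 hx.2) _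

theorem measurable_stochGrad_add (f : Ξ → Vec n → ℝ) (d : Fin Q → Ξ) (x : Vec n) :
    Measurable fun w : Finset (Fin Q) × Vec n => stochGrad f d Bs w.1 x + w.2 :=
  measurable_from_prod_countable_right fun _ => by fun_prop

/-- Exchanging one gradient moves the batch mean by at most 2Bg/Bs; noise above the level ϖ only
helps, through the factor σ²/ϖ² ≥ 1. -/
theorem norm_sq_inv_smul_sub_le {Bg σ ϖ : ℝ} (hBs : 0 < Bs) (hϖ : 0 < ϖ) (hσ : ϖ ≤ σ) {v w : Vec n}
    (hv : ‖v‖ ≤ Bg) (hw : ‖w‖ ≤ Bg) :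
    ‖(Bs : ℝ)⁻¹ • (v - w)‖ ^ 2 ≤ 4 * Bg ^ 2 / (ϖ ^ 2 * (Bs : ℝ) ^ 2) * σ ^ 2 := by
  have hB : (0 : ℝ) < Bs := by exact_mod_cast hBs
  have h1 : ‖v - w‖ ≤ 2 * Bg := (norm_sub_le v w).trans (by linarith)
  have h2 : ‖v - w‖ ^ 2 ≤ 4 * Bg ^ 2 := by nlinarith [norm_nonneg (v - w)]
  have h3 : 1 ≤ σ ^ 2 / ϖ ^ 2 := by
    rw [one_le_div (by positivity)]
    gcongr
  rw [norm_smul, mul_pow, norm_inv, Real.norm_of_nonneg hB.le, inv_pow]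
  calc ((Bs : ℝ) ^ 2)⁻¹ * ‖v - w‖ ^ 2 ≤ ((Bs : ℝ) ^ 2)⁻¹ * (4 * Bg ^ 2) := by gcongr
    _ ≤ ((Bs : ℝ) ^ 2)⁻¹ * (4 * Bg ^ 2) * (σ ^ 2 / ϖ ^ 2) :=
        le_mul_of_one_le_right (by positivity) h3
    _ = _ := by field_simp

/-- Replacing one sample of an agent: the dual Rényi bound for one masked stochastic gradient. -/
theorem lintegral_masked_gradient_le (f : Ξ → Vec n → ℝ) {Bg ϖ σ u α p : ℝ}
    (hbound : ∀ ξ x, ‖gradient (f ξ) x‖ ≤ Bg) (hBs : 0 < Bs) (hBsQ : Bs < Q)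
    (hϖ : 0 < ϖ) (hσ : ϖ ≤ σ) (hu : u = 4 * Bg ^ 2 / (ϖ ^ 2 * (Bs : ℝ) ^ 2)) (hu0 : 0 < u)
    (hu1 : u ≤ 2 / 3) (hpα : p.HolderConjugate α)
    (hq : (Bs : ℝ) / Q ≤ Real.exp (-α) * (u / (1 + u)))
    {d d' : Fin Q → Ξ} {a : Fin Q} (hd : ∀ r, r ≠ a → d r = d' r) (x : Vec n)
    {F : Vec n → ℝ≥0∞} (hF : Measurable F) :
    ∫⁻ w, F (stochGrad f d Bs w.1 x + w.2) ∂(batchLaw Q Bs).prod (gaussianNoise n σ)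
      ≤ ENNReal.ofReal (1 + 5 * α * (α - 1) * ((Bs : ℝ) / Q) ^ 2 * u) ^ (1 / α) *
        (∫⁻ w, F (stochGrad f d' Bs w.1 x + w.2) ^ p
          ∂(batchLaw Q Bs).prod (gaussianNoise n σ)) ^ (1 / p) := by
  have hB : (0 : ℝ) < Bs := by exact_mod_cast hBs
  have hBQ : (Bs : ℝ) < Q := by exact_mod_cast hBsQ
  have hQ0 : (0 : ℝ) < Q := hB.trans hBQ
  have := isProbabilityMeasure_gaussianNoise n σ
  have hm1 : Measurable fun w : Finset (Fin Q) × Vec n => F (stochGrad f d Bs w.1 x + w.2) :=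
    hF.comp (measurable_stochGrad_add f d x)
  have hm2 : Measurable fun w : Finset (Fin Q) × Vec n => F (stochGrad f d' Bs w.1 x + w.2) ^ p :=
    (hF.comp (measurable_stochGrad_add f d' x)).pow_const p
  rw [lintegral_prod _ hm1.aemeasurable, lintegral_prod _ hm2.aemeasurable]
  refine batch_average_le_of_swap hBs hBsQ a hpα.lt.le _
    (fun S => ∫⁻ z, F (stochGrad f d Bs S x + z) ∂gaussianNoise n σ)
    (fun S => ∫⁻ z, F (stochGrad f d' Bs S x + z) ^ p ∂gaussianNoise n σ) fun S r _ ha hr => ?_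
  have hsame : ∀ T : Finset (Fin Q), a ∉ T →
      ∑ q ∈ T, gradient (f (d q)) x = ∑ q ∈ T, gradient (f (d' q)) x := fun T hT =>
    sum_congr rfl fun q hq => by rw [hd q fun h => hT (h ▸ hq)]
  have ha' : a ∉ S.erase r := fun h => ha (mem_of_mem_erase h)
  -- A batch that avoids a does not see the change: this is the common mixture component.
  have eS : stochGrad f d' Bs S x = stochGrad f d Bs S x := by
    rw [stochGrad, stochGrad, hsame S ha]
  have e1 : stochGrad f d Bs (insert a (S.erase r)) x - stochGrad f d Bs S x
      = (Bs : ℝ)⁻¹ • (gradient (f (d a)) x - gradient (f (d r)) x) := by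
    rw [stochGrad, stochGrad, ← smul_sub, sum_insert ha', ← add_sum_erase S _ hr]
    congr 1; abel
  have e2 : stochGrad f d' Bs (insert a (S.erase r)) x - stochGrad f d Bs S x
      = (Bs : ℝ)⁻¹ • (gradient (f (d' a)) x - gradient (f (d r)) x) := by
    rw [stochGrad, stochGrad, ← smul_sub, sum_insert ha', ← hsame _ ha', ← add_sum_erase S _ hr]
    congr 1; abel
  have e3 : stochGrad f d Bs (insert a (S.erase r)) x - stochGrad f d' Bs (insert a (S.erase r)) x
      = (Bs : ℝ)⁻¹ • (gradient (f (d a)) x - gradient (f (d' a)) x) := by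
    rw [stochGrad, stochGrad, ← smul_sub, sum_insert ha', sum_insert ha', ← hsame _ ha']
    congr 1; abel
  simp only [eS]
  have hn : ∀ ξ ξ' : Ξ, ‖(Bs : ℝ)⁻¹ • (gradient (f ξ) x - gradient (f ξ') x)‖ ^ 2 ≤ u * σ ^ 2 :=
    fun ξ ξ' => by rw [hu]; exact norm_sq_inv_smul_sub_le hBs hϖ hσ (hbound _ _) (hbound _ _)
  exact lintegral_gaussianNoise_mixture_le hpα hu0 hu1 (hϖ.trans_le hσ) (by rw [e1]; exact hn _ _)
    (by rw [e2]; exact hn _ _) (by rw [e3]; exact hn _ _) (by positivity) hq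
    ((div_le_one hQ0).2 hBQ.le) hF

end DPSCC

/-! ### Products over the agents. -/

section HolderProduct
open scoped ENNReal

/-- A dual Rényi bound for one coordinate of a product carries over to the whole product. -/
theorem lintegral_pi_le_of_coordinate {R X Y : Type*} [Fintype R] [MeasurableSpace X]
    [MeasurableSpace Y] (μ : R → Measure X) [∀ i, IsProbabilityMeasure (μ i)] {p α : ℝ}
    (hpα : p.HolderConjugate α) (C : ℝ≥0∞) (φ φ' : R → X → Y) (hφ : ∀ i, Measurable (φ i))
    (hφ' : ∀ i, Measurable (φ' i)) (i : R) (hne : ∀ j, j ≠ i → φ j = φ' j)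
    (hi : ∀ F : Y → ℝ≥0∞, Measurable F →
      ∫⁻ x, F (φ i x) ∂μ i ≤ C * (∫⁻ x, F (φ' i x) ^ p ∂μ i) ^ (1 / p))
    {F : (R → Y) → ℝ≥0∞} (hF : Measurable F) :
    ∫⁻ x, F (fun j => φ j (x j)) ∂Measure.pi μ
      ≤ C * (∫⁻ x, F (fun j => φ' j (x j)) ^ p ∂Measure.pi μ) ^ (1 / p) := by
  classical
  have hX : Nonempty X := (μ i).nonempty_of_neZero
  let x0 : R → X := fun _ => hX.some
  have m1 : Measurable fun x : R → X => F (fun j => φ j (x j)) :=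
    hF.comp (measurable_pi_lambda _ fun j => (hφ j).comp (measurable_pi_apply j))
  have m2 : Measurable fun x : R → X => F (fun j => φ' j (x j)) ^ p :=
    (hF.comp (measurable_pi_lambda _ fun j => (hφ' j).comp (measurable_pi_apply j))).pow_const p
  have upd : ∀ (ψ : R → X → Y) (x : R → X) (t : X),
      (fun j => ψ j (Function.update x i t j)) = Function.update (fun j => ψ j (x j)) i (ψ i t) := by
    intro ψ x t
    ext j
    rcases eq_or_ne j i with rfl | hj
    · simp
    · simp [hj]
  have inner : ∀ x : R → X, ∫⁻ t, F (fun j => φ j (Function.update x i t j)) ∂μ i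
      ≤ C * (∫⁻ t, F (fun j => φ' j (Function.update x i t j)) ^ p ∂μ i) ^ (1 / p) := by
    intro x
    have e : ∀ y, Function.update (fun j => φ j (x j)) i y = Function.update (fun j => φ' j (x j)) i y :=
      fun y => by
        ext j
        rcases eq_or_ne j i with rfl | hj
        · simp
        · simp [hj, hne j hj]
    simp only [upd, e]
    exact hi (fun y => F (Function.update (fun j => φ' j (x j)) i y))
      (hF.comp (measurable_update _))
  -- Coordinate i is integrated innermost, with the others frozen. Every coordinate is integrated in
  -- the end, so the base point `x0` is immaterial.
  rw [lintegral_eq_lmarginal_univ x0, lintegral_eq_lmarginal_univ (μ := μ) x0,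
    lmarginal_erase' _ m1 (Finset.mem_univ i), lmarginal_erase' _ m2 (Finset.mem_univ i)]
  have m3 : Measurable fun x : R → X =>
      ∫⁻ t, F (fun j => φ' j (Function.update x i t j)) ^ p ∂μ i := by
    have : Measurable fun q : (R → X) × X => F (fun j => φ' j (Function.update q.1 i q.2 j)) ^ p := by
      refine m2.comp (g := fun x : R → X => F (fun j => φ' j (x j)) ^ p)
        (f := fun q : (R → X) × X => Function.update q.1 i q.2) measurable_update'
    exact this.lintegral_prod_right'
  refine (lmarginal_mono inner x0).trans ?_
  unfold lmarginal
  have m4 : Measurable fun y : ((j : (Finset.univ.erase i : Finset R)) → X) =>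
      Function.updateFinset x0 (Finset.univ.erase i) y := measurable_updateFinset
  have m5 : Measurable fun y : ((j : (Finset.univ.erase i : Finset R)) → X) =>
      ∫⁻ t, F (fun j => φ' j (Function.update (Function.updateFinset x0 (Finset.univ.erase i) y)
        i t j)) ^ p ∂μ i := m3.comp m4
  simp only []
  rw [lintegral_const_mul _ (m5.pow_const _)]
  gcongr
  exact lintegral_rpow_one_div_le _ hpα m5

end HolderProduct

/-! ### Measurability of the algorithm and adaptive composition. -/

namespace DPSCC
open scoped ENNReal

variable {R B U Ξ : Type*} {n Q Bs : ℕ}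

@[fun_prop]
theorem measurable_init {Y : Type*} [MeasurableSpace Y] (k : ℕ) :
    Measurable fun g : Fin (k + 1) → Y => (Fin.init g : Fin k → Y) :=
  measurable_pi_lambda _ fun _ => measurable_pi_apply _

theorem measurable_snoc {Y : Type*} [MeasurableSpace Y] (k : ℕ) :
    Measurable fun q : (Fin k → Y) × Y => (Fin.snoc (α := fun _ => Y) q.1 q.2 : Fin (k + 1) → Y) := by
  refine measurable_pi_lambda _ fun l => ?_
  induction l using Fin.lastCases with
  | last => simpa using measurable_snd
  | cast l => simpa [Function.comp_def] using (measurable_pi_apply l).comp measurable_fst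

theorem measurable_clip {X : Type*} [MeasurableSpace X] {v : X → Vec n} {τ : X → ℝ}
    (hv : Measurable v) (hτ : Measurable τ) : Measurable fun x => clip (v x) (τ x) :=
  (measurable_const.min (hτ.div hv.norm)).smul hv

theorem measurable_scc (A : Setup R B U n) (hclip : ∀ k i, Measurable (A.clipRadius k i))
    (k : ℕ) (i : R) {X : Type*} [MeasurableSpace X] {own : X → Vec n} {recv : X → R ⊕ B → Vec n}
    (ho : Measurable own) (hr : Measurable recv) :
    Measurable fun x => A.scc k i (own x) (recv x) := by
  unfold Setup.scc
  refine Finset.measurable_fun_sum _ fun j _ => ?_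
  exact (ho.add (measurable_clip (((measurable_pi_apply j).comp hr).sub ho)
    ((hclip k i).comp hr))).fun_const_smul (A.weight i j)

/-- The masked gradients of all agents at one iteration. -/
noncomputable def Setup.maskedRow (A : Setup R B U n) (f : R → Ξ → Vec n → ℝ) (D : R → Fin Q → Ξ) (Bs : ℕ)
    (u : U) (k : ℕ) (g : Fin k → R → Vec n) (w : R → Finset (Fin Q) × Vec n) : R → Vec n :=
  fun i => stochGrad (f i) (D i) Bs (w i).1 (A.decision u k g i) + (w i).2

theorem Setup.masked_succ (A : Setup R B U n) (f : R → Ξ → Vec n → ℝ) (D : R → Fin Q → Ξ) (Bs : ℕ)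
    (u : U) (k : ℕ) (ω : Fin (k + 1) → R → Finset (Fin Q) × Vec n) :
    A.masked f D Bs u (k + 1) ω = Fin.snoc (α := fun _ => R → Vec n)
      (A.masked f D Bs u k (Fin.init ω))
      (A.maskedRow f D Bs u k (A.masked f D Bs u k (Fin.init ω)) (ω (Fin.last k))) := rfl

variable [MeasurableSpace U]

theorem measurable_decision (A : Setup R B U n) (hclip : ∀ k i, Measurable (A.clipRadius k i))
    (hattack : ∀ k, Measurable (fun p : U × (Fin (k + 1) → R → Vec n) => A.attack k p.1 p.2))
    (k : ℕ) : Measurable fun p : U × (Fin k → R → Vec n) => A.decision p.1 k p.2 := by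
  induction k with
  | zero => exact measurable_const
  | succ k ih =>
    have hx : Measurable fun p : U × (Fin (k + 1) → R → Vec n) =>
        A.decision p.1 k (Fin.init p.2) :=
      ih.comp (measurable_fst.prodMk ((measurable_init k).comp measurable_snd))
    have hy : ∀ j, Measurable fun p : U × (Fin (k + 1) → R → Vec n) =>
        A.decision p.1 k (Fin.init p.2) j - A.stepSize k • p.2 (Fin.last k) j := fun j =>
      ((measurable_pi_apply j).comp hx).sub (((measurable_pi_apply j).comp
        ((measurable_pi_apply (Fin.last k)).comp measurable_snd)).fun_const_smul (A.stepSize k))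
    refine measurable_pi_lambda _ fun i => measurable_scc A hclip k i (hy i) ?_
    refine measurable_pi_lambda _ fun j => ?_
    cases j with
    | inl j => exact hy j
    | inr b => exact (measurable_pi_apply i).comp ((measurable_pi_apply b).comp (hattack k))

theorem measurable_gradient (f : Vec n → ℝ) : Measurable (gradient f) :=
  (InnerProductSpace.toDual ℝ (Vec n)).symm.continuous.measurable.comp (measurable_fderiv ℝ f)

theorem measurable_stochGrad {X : Type*} [MeasurableSpace X] (f : Ξ → Vec n → ℝ) (d : Fin Q → Ξ)
    {S : X → Finset (Fin Q)} {x : X → Vec n} (hS : Measurable S) (hx : Measurable x) :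
    Measurable fun t => stochGrad f d Bs (S t) (x t) := by
  have h : ∀ T : Finset (Fin Q), Measurable (stochGrad f d Bs T) := fun T => by
    have hsum : Measurable fun y => ∑ r ∈ T, gradient (f (d r)) y :=
      Finset.measurable_fun_sum T fun r _ => measurable_gradient (f (d r))
    exact hsum.fun_const_smul (Bs : ℝ)⁻¹
  have h' : Measurable fun q : Finset (Fin Q) × Vec n => stochGrad f d Bs q.1 q.2 :=
    measurable_from_prod_countable_right h
  have h2 := h'.comp (hS.prodMk hx)
  simp only [Function.comp_def] at h2
  exact h2

theorem measurable_maskedRow (A : Setup R B U n) (hclip : ∀ k i, Measurable (A.clipRadius k i))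
    (hattack : ∀ k, Measurable (fun p : U × (Fin (k + 1) → R → Vec n) => A.attack k p.1 p.2))
    (f : R → Ξ → Vec n → ℝ) (D : R → Fin Q → Ξ) (k : ℕ) {X : Type*} [MeasurableSpace X]
    {u : X → U} {g : X → Fin k → R → Vec n} {w : X → R → Finset (Fin Q) × Vec n}
    (hu : Measurable u) (hg : Measurable g) (hw : Measurable w) :
    Measurable fun x => A.maskedRow f D Bs (u x) k (g x) (w x) := by
  refine measurable_pi_lambda _ fun i => ?_
  have hwi := (measurable_pi_apply i).comp hw
  exact (measurable_stochGrad (f i) (D i) (measurable_fst.comp hwi) ((measurable_pi_apply i).comp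
    ((measurable_decision A hclip hattack k).comp (hu.prodMk hg)))).add (measurable_snd.comp hwi)

theorem measurable_masked (A : Setup R B U n) (hclip : ∀ k i, Measurable (A.clipRadius k i))
    (hattack : ∀ k, Measurable (fun p : U × (Fin (k + 1) → R → Vec n) => A.attack k p.1 p.2))
    (f : R → Ξ → Vec n → ℝ) (D : R → Fin Q → Ξ) (k : ℕ) :
    Measurable fun p : U × (Fin k → R → Finset (Fin Q) × Vec n) =>
      A.masked f D Bs p.1 k p.2 := by
  induction k with
  | zero => exact measurable_pi_lambda _ fun l => l.elim0
  | succ k ih =>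
    simp only [Setup.masked_succ]
    have hg : Measurable fun p : U × (Fin (k + 1) → R → Finset (Fin Q) × Vec n) =>
        A.masked f D Bs p.1 k (Fin.init p.2) :=
      ih.comp (measurable_fst.prodMk ((measurable_init k).comp measurable_snd))
    exact (measurable_snoc k).comp (hg.prodMk (measurable_maskedRow A hclip hattack f D k
      measurable_fst hg ((measurable_pi_apply _).comp measurable_snd)))

/-- Integration over the last coordinate of a finite sequence. -/
theorem lintegral_pi_snoc {X : Type*} [MeasurableSpace X] {k : ℕ} (μ : ℕ → Measure X)
    [∀ l, IsProbabilityMeasure (μ l)] {G : (Fin (k + 1) → X) → ℝ≥0∞} (hG : Measurable G) :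
    ∫⁻ ω, G ω ∂Measure.pi (fun l : Fin (k + 1) => μ l)
      = ∫⁻ ω, ∫⁻ x, G (Fin.snoc (α := fun _ => X) ω x) ∂μ k ∂Measure.pi (fun l : Fin k => μ l) := by
  have h := (measurePreserving_piFinSuccAbove (fun l : Fin (k + 1) => μ l) (Fin.last k)).symm
  have hm : Measurable fun z => G ((MeasurableEquiv.piFinSuccAbove (fun _ => X) (Fin.last k)).symm z) :=
    hG.comp h.measurable
  rw [← h.lintegral_comp hG, lintegral_prod_symm _ hm.aemeasurable]
  simp only [Fin.succAbove_last, Fin.val_castSucc, Fin.val_last]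
  refine lintegral_congr fun ω => lintegral_congr fun x => ?_
  congr 1
  rw [MeasurableEquiv.piFinSuccAbove_symm_apply]
  exact Fin.insertNth_last' x ω

/-- Adaptive composition: a dual Rényi bound for each iteration, whatever happened before, gives one
for all masked gradients. -/
theorem lintegral_masked_le (A : Setup R B U n) (hclip : ∀ k i, Measurable (A.clipRadius k i))
    (hattack : ∀ k, Measurable (fun p : U × (Fin (k + 1) → R → Vec n) => A.attack k p.1 p.2))
    (f : R → Ξ → Vec n → ℝ) (D D' : R → Fin Q → Ξ)
    (μ : ℕ → Measure (R → Finset (Fin Q) × Vec n)) [∀ l, IsProbabilityMeasure (μ l)] {p α : ℝ}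
    (hpα : p.HolderConjugate α) (C : ℝ≥0∞) (u : U)
    (hstep : ∀ (k : ℕ) (g : Fin k → R → Vec n) (F : (R → Vec n) → ℝ≥0∞), Measurable F →
      ∫⁻ w, F (A.maskedRow f D Bs u k g w) ∂μ k
        ≤ C * (∫⁻ w, F (A.maskedRow f D' Bs u k g w) ^ p ∂μ k) ^ (1 / p))
    (k : ℕ) {F : (Fin k → R → Vec n) → ℝ≥0∞} (hF : Measurable F) :
    ∫⁻ ω, F (A.masked f D Bs u k ω) ∂Measure.pi (fun l : Fin k => μ l)
      ≤ C ^ k * (∫⁻ ω, F (A.masked f D' Bs u k ω) ^ p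
        ∂Measure.pi (fun l : Fin k => μ l)) ^ (1 / p) := by
  have hM : ∀ (E : R → Fin Q → Ξ) (k : ℕ), Measurable fun ω => A.masked f E Bs u k ω := fun E k =>
    (measurable_masked A hclip hattack f E k).comp (measurable_const.prodMk measurable_id)
  induction k with
  | zero =>
    have e : ∀ E : R → Fin Q → Ξ, ∀ ω, A.masked f E Bs u 0 ω = Fin.elim0 := fun _ _ => rfl
    simp only [e, lintegral_const, measure_univ, mul_one, pow_zero, one_mul]
    rw [← ENNReal.rpow_mul, one_div, mul_inv_cancel₀ hpα.ne_zero, ENNReal.rpow_one]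
  | succ k ih =>
    have m1 : Measurable fun ω => F (A.masked f D Bs u (k + 1) ω) := hF.comp (hM D (k + 1))
    have m2 : Measurable fun ω => F (A.masked f D' Bs u (k + 1) ω) ^ p :=
      (hF.comp (hM D' (k + 1))).pow_const p
    rw [lintegral_pi_snoc μ m1, lintegral_pi_snoc μ m2]
    simp only [Setup.masked_succ, Fin.init_snoc, Fin.snoc_last]
    have hsn : ∀ g : Fin k → R → Vec n, Measurable fun y : R → Vec n =>
        F (Fin.snoc (α := fun _ => R → Vec n) g y) := fun g =>
      hF.comp ((measurable_snoc k).comp (measurable_const.prodMk measurable_id))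
    have hH : Measurable fun g : Fin k → R → Vec n => ∫⁻ w,
        F (Fin.snoc (α := fun _ => R → Vec n) g (A.maskedRow f D' Bs u k g w)) ^ p ∂μ k := by
      have : Measurable fun q : (Fin k → R → Vec n) × (R → Finset (Fin Q) × Vec n) =>
          F (Fin.snoc (α := fun _ => R → Vec n) q.1 (A.maskedRow f D' Bs u k q.1 q.2)) ^ p :=
        (hF.comp ((measurable_snoc k).comp (measurable_fst.prodMk (measurable_maskedRow A hclip
          hattack f D' k measurable_const measurable_fst measurable_snd)))).pow_const p
      exact this.lintegral_prod_right'
    refine (lintegral_mono fun ω => hstep k (A.masked f D Bs u k ω) _ (hsn _)).trans ?_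
    have m3 := (hH.comp (hM D k)).pow_const (1 / p)
    simp only [Function.comp_def] at m3
    rw [lintegral_const_mul _ m3, pow_succ', mul_assoc]
    gcongr
    -- The last iteration has been moved to D' for each fixed past, leaving H^(1/p) of a past
    -- produced from D. The induction hypothesis for H^(1/p) moves the past too, and its p-th power
    -- restores H.
    refine (ih (hH.pow_const (1 / p))).trans (le_of_eq ?_)
    simp only [← ENNReal.rpow_mul, one_div, inv_mul_cancel₀ hpα.ne_zero, ENNReal.rpow_one]

end DPSCC

/-- Conversion of a (dual) Rényi bound of order `α` into an `(ε, δ)`-bound. -/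
theorem le_exp_mul_add_of_le_exp_mul_rpow {x y a α δ : ℝ} (hα : 1 < α) (hδ : 0 < δ) (hx : 0 ≤ x)
    (h : y ≤ Real.exp ((α - 1) * a) * x ^ (1 - 1 / α)) :
    y ≤ Real.exp (a * α + Real.log (1 / δ) / (α - 1)) * x + δ := by
  have hα0 : 0 < α := by linarith
  have hα1 : 0 < α - 1 := by linarith
  have he : 0 < 1 - 1 / α := by rw [sub_pos, div_lt_one hα0]; exact hα
  -- In terms of z the hypothesis is y ≤ z^(1-1/α), since aα(1 - 1/α) = (α-1)a.
  set z := Real.exp (a * α) * x with hz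
  have hz0 : 0 ≤ z := by positivity
  have h1 : y ≤ z ^ (1 - 1 / α) := by
    rw [hz, Real.mul_rpow (Real.exp_pos _).le hx, ← Real.exp_mul]
    have : a * α * (1 - 1 / α) = (α - 1) * a := by field_simp
    rwa [this]
  -- At this threshold z^(1-1/α) = δ. Below it y ≤ δ; above it z^(-1/α) ≤ δ^(-1/(α-1)), which bounds
  -- y by a multiple of z.
  rcases le_total z (δ ^ (α / (α - 1))) with hc | hc
  · have h2 : z ^ (1 - 1 / α) ≤ δ := by
      refine (Real.rpow_le_rpow hz0 hc he.le).trans (le_of_eq ?_)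
      rw [← Real.rpow_mul hδ.le]
      have : α / (α - 1) * (1 - 1 / α) = 1 := by field_simp
      rw [this, Real.rpow_one]
    have : 0 ≤ Real.exp (a * α + Real.log (1 / δ) / (α - 1)) * x := by positivity
    linarith
  · have hzpos : 0 < z := (Real.rpow_pos_of_pos hδ _).trans_le hc
    have h2 : z ^ (-(1 / α)) ≤ Real.exp (Real.log (1 / δ) / (α - 1)) := by
      refine (Real.rpow_le_rpow_of_nonpos (Real.rpow_pos_of_pos hδ _) hc
        (by have := one_div_pos.2 hα0; linarith)).trans (le_of_eq ?_)
      rw [← Real.rpow_mul hδ.le, Real.rpow_def_of_pos hδ, one_div δ, Real.log_inv]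
      congr 1
      field_simp
    have h3 : z ^ (1 - 1 / α) = z * z ^ (-(1 / α)) := by
      rw [sub_eq_add_neg, Real.rpow_add hzpos, Real.rpow_one]
    rw [h3] at h1
    have h4 := mul_le_mul_of_nonneg_left h2 hz0
    have h5 : z * Real.exp (Real.log (1 / δ) / (α - 1))
        = Real.exp (a * α + Real.log (1 / δ) / (α - 1)) * x := by
      rw [Real.exp_add, hz]; ring
    linarith

/-! ### The whole algorithm: post-processing and the average over the seed. -/

namespace DPSCC
open scoped ENNReal

variable {R B U Ξ : Type*} {n Q Bs : ℕ}

/-- Everything that is released, as a function of the seed and of all masked gradients. -/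
noncomputable def Setup.viewOf (A : Setup R B U n) (K : ℕ) (p : U × (Fin K → R → Vec n)) : View R B U n K :=
  (p.1, p.2, A.transmitted p.1 p.2, fun k => A.attack k p.1 (prefixOf p.2 (k + 1) k.2),
    fun k => A.decision p.1 k (prefixOf p.2 k (Nat.lt_succ_iff.mp k.2)))

theorem measurable_prefixOf {Y : Type*} [MeasurableSpace Y] {K : ℕ} (k : ℕ) (hk : k ≤ K) :
    Measurable fun g : Fin K → Y => prefixOf g k hk :=
  measurable_pi_lambda _ fun _ => measurable_pi_apply _

theorem measurable_viewOf [MeasurableSpace U] (A : Setup R B U n)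
    (hclip : ∀ k i, Measurable (A.clipRadius k i))
    (hattack : ∀ k, Measurable (fun p : U × (Fin (k + 1) → R → Vec n) => A.attack k p.1 p.2))
    (K : ℕ) : Measurable (A.viewOf K) := by
  have hpre : ∀ (k : ℕ) (hk : k ≤ K), Measurable fun p : U × (Fin K → R → Vec n) =>
      (p.1, prefixOf p.2 k hk) := fun k hk =>
    measurable_fst.prodMk ((measurable_prefixOf k hk).comp measurable_snd)
  have hdec : ∀ (k : ℕ) (hk : k ≤ K), Measurable fun p : U × (Fin K → R → Vec n) =>
      A.decision p.1 k (prefixOf p.2 k hk) := fun k hk =>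
    (measurable_decision A hclip hattack k).comp (hpre k hk)
  have htr : Measurable fun p : U × (Fin K → R → Vec n) => A.transmitted p.1 p.2 := by
    refine measurable_pi_lambda _ fun k => measurable_pi_lambda _ fun i => ?_
    have h1 : Measurable fun p : U × (Fin K → R → Vec n) => p.2 k i :=
      (measurable_pi_apply i).comp ((measurable_pi_apply k).comp measurable_snd)
    exact ((measurable_pi_apply i).comp (hdec k k.2.le)).sub (h1.fun_const_smul (A.stepSize k))
  exact measurable_fst.prodMk (measurable_snd.prodMk (htr.prodMk
    ((measurable_pi_lambda _ fun k : Fin K => (hattack k).comp (hpre (k + 1) k.2)).prodMk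
      (measurable_pi_lambda _ fun k : Fin (K + 1) => hdec k (Nat.lt_succ_iff.mp k.2)))))

/-- The dual Rényi bound for the probabilities of events about the whole algorithm, given such a
bound for each iteration. -/
theorem algorithm_measure_le [Fintype R] [MeasurableSpace U] (A : Setup R B U n)
    (hclip : ∀ k i, Measurable (A.clipRadius k i))
    (hattack : ∀ k, Measurable (fun p : U × (Fin (k + 1) → R → Vec n) => A.attack k p.1 p.2))
    (ν : Measure U) [IsProbabilityMeasure ν] (f : R → Ξ → Vec n → ℝ) (D D' : R → Fin Q → Ξ)
    (μ : ℕ → Measure (R → Finset (Fin Q) × Vec n)) [∀ l, IsProbabilityMeasure (μ l)] {p α : ℝ}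
    (hpα : p.HolderConjugate α) {C : ℝ≥0∞}
    (hstep : ∀ (u : U) (k : ℕ) (g : Fin k → R → Vec n) (F : (R → Vec n) → ℝ≥0∞), Measurable F →
      ∫⁻ w, F (A.maskedRow f D Bs u k g w) ∂μ k
        ≤ C * (∫⁻ w, F (A.maskedRow f D' Bs u k g w) ^ p ∂μ k) ^ (1 / p))
    (K : ℕ) {T : Set (View R B U n K)} (hT : MeasurableSet T) :
    (ν.prod (Measure.pi fun k : Fin K => μ k)) {ω | A.algorithm f Bs K D ω ∈ T}
      ≤ C ^ K * ((ν.prod (Measure.pi fun k : Fin K => μ k))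
        {ω | A.algorithm f Bs K D' ω ∈ T}) ^ (1 / p) := by
  set T' : Set (U × (Fin K → R → Vec n)) := A.viewOf K ⁻¹' T
  have hT' : MeasurableSet T' := measurable_viewOf A hclip hattack K hT
  set F : U × (Fin K → R → Vec n) → ℝ≥0∞ := T'.indicator 1 with hFdef
  have hF : Measurable F := measurable_one.indicator hT'
  -- An indicator equals its p-th power, so the dual bound becomes one between probabilities.
  have hFp : ∀ x, F x ^ p = F x := fun x => by
    by_cases hx : x ∈ T'
    · rw [hFdef, Set.indicator_of_mem hx, Pi.one_apply, ENNReal.one_rpow]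
    · rw [hFdef, Set.indicator_of_notMem hx, ENNReal.zero_rpow_of_pos hpα.pos]
  have hm : ∀ E : R → Fin Q → Ξ, Measurable
      fun ω : U × (Fin K → R → Finset (Fin Q) × Vec n) => F (ω.1, A.masked f E Bs ω.1 K ω.2) :=
    fun E => hF.comp (measurable_fst.prodMk (measurable_masked A hclip hattack f E K))
  have hP : ∀ E : R → Fin Q → Ξ,
      (ν.prod (Measure.pi fun k : Fin K => μ k)) {ω | A.algorithm f Bs K E ω ∈ T}
        = ∫⁻ u, ∫⁻ ω, F (u, A.masked f E Bs u K ω) ∂Measure.pi (fun k : Fin K => μ k) ∂ν := by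
    intro E
    have hS : MeasurableSet {ω | A.algorithm f Bs K E ω ∈ T} :=
      (measurable_fst.prodMk (measurable_masked A hclip hattack f E K)) hT'
    rw [← lintegral_prod _ (hm E).aemeasurable, ← lintegral_indicator_one hS]
    rfl
  rw [hP D, hP D']
  have hu : ∀ u, ∫⁻ ω, F (u, A.masked f D Bs u K ω) ∂Measure.pi (fun k : Fin K => μ k)
      ≤ C ^ K * (∫⁻ ω, F (u, A.masked f D' Bs u K ω)
        ∂Measure.pi (fun k : Fin K => μ k)) ^ (1 / p) := fun u => by
    have hFu : Measurable fun g => F (u, g) := hF.comp (measurable_const.prodMk measurable_id)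
    have := lintegral_masked_le A hclip hattack f D D' μ hpα C u (hstep u) K hFu
    simpa only [hFp] using this
  have hH : Measurable fun u => ∫⁻ ω, F (u, A.masked f D' Bs u K ω)
      ∂Measure.pi (fun k : Fin K => μ k) := (hm D').lintegral_prod_right'
  refine (lintegral_mono hu).trans ?_
  rw [lintegral_const_mul _ (hH.pow_const _)]
  gcongr
  exact lintegral_rpow_one_div_le ν hpα hH

/-- The dual Rényi bound for one iteration of all agents on adjacent samples. -/
theorem lintegral_maskedRow_le [Fintype R] [MeasurableSpace U] (A : Setup R B U n)
    (f : R → Ξ → Vec n → ℝ) {Bg ϖ u α p : ℝ} {σ : R → ℕ → ℝ}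
    (hbound : ∀ i ξ x, ‖gradient (f i ξ) x‖ ≤ Bg) (hBs : 0 < Bs) (hBsQ : Bs < Q)
    (hϖ : 0 < ϖ) (hσ : ∀ i k, ϖ ≤ σ i k) (hu : u = 4 * Bg ^ 2 / (ϖ ^ 2 * (Bs : ℝ) ^ 2))
    (hu0 : 0 < u) (hu1 : u ≤ 2 / 3) (hpα : p.HolderConjugate α)
    (hq : (Bs : ℝ) / Q ≤ Real.exp (-α) * (u / (1 + u))) {D D' : R → Fin Q → Ξ}
    (hD : Adjacent D D') (s : U) (k : ℕ) (g : Fin k → R → Vec n) {F : (R → Vec n) → ℝ≥0∞}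
    (hF : Measurable F) :
    ∫⁻ w, F (A.maskedRow f D Bs s k g w)
        ∂Measure.pi (fun i => (batchLaw Q Bs).prod (gaussianNoise n (σ i k)))
      ≤ ENNReal.ofReal (1 + 5 * α * (α - 1) * ((Bs : ℝ) / Q) ^ 2 * u) ^ (1 / α) *
        (∫⁻ w, F (A.maskedRow f D' Bs s k g w) ^ p
          ∂Measure.pi (fun i => (batchLaw Q Bs).prod (gaussianNoise n (σ i k)))) ^ (1 / p) := by
  obtain ⟨i, a, h⟩ := hD
  have := isProbabilityMeasure_batchLaw hBsQ.le
  have := fun σ => isProbabilityMeasure_gaussianNoise n σ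
  refine lintegral_pi_le_of_coordinate
    (fun i => (batchLaw Q Bs).prod (gaussianNoise n (σ i k))) hpα _
    (fun j w => stochGrad (f j) (D j) Bs w.1 (A.decision s k g j) + w.2)
    (fun j w => stochGrad (f j) (D' j) Bs w.1 (A.decision s k g j) + w.2)
    (fun j => measurable_stochGrad_add (Bs := Bs) (f j) (D j) _)
    (fun j => measurable_stochGrad_add (Bs := Bs) (f j) (D' j) _) i
    (fun j hj => ?_) (fun F hF => ?_) hF
  · have : D j = D' j := funext fun r => h j r fun e => hj (congrArg Prod.fst e)
    simp only [this]
  · exact lintegral_masked_gradient_le (f i) (hbound i) hBs hBsQ hϖ (hσ i k) hu hu0 hu1 hpα hq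
      (fun r hr => h i r fun e => hr (congrArg Prod.snd e)) _ hF

end DPSCC

/-! ### Choice of the order and assembly of the bounds. -/

theorem theorem5 {R B U Ξ : Type*} [Fintype R] [Fintype B] [MeasurableSpace U] {n : ℕ}
    -- the system, with measurable clipping parameters and a measurable Byzantine attack
    (A : DPSCC.Setup R B U n)
    (hclip : ∀ k i, Measurable (A.clipRadius k i))
    (hattack : ∀ k, Measurable (fun p : U × (Fin (k + 1) → R → DPSCC.Vec n) => A.attack k p.1 p.2))
    (ν : MeasureTheory.Measure U) [MeasureTheory.IsProbabilityMeasure ν]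
    -- the local losses, whose gradients are bounded by `Bg`
    (f : R → Ξ → DPSCC.Vec n → ℝ) (hf : ∀ i ξ, Differentiable ℝ (f i ξ))
    (Bg : ℝ) (hBg : 0 < Bg) (hbound : ∀ i ξ x, ‖gradient (f i ξ) x‖ ≤ Bg)
    -- number of samples, batch size, number of iterations
    (Q Bs K : ℕ) (hBs : 0 < Bs) (hBsQ : Bs ≤ Q) (hK : 0 < K)
    -- the noise has standard deviation at least `ϖ`
    (ϖ : ℝ) (hϖ : 0 < ϖ) (σ : R → ℕ → ℝ) (hσ : ∀ i k, ϖ ≤ σ i k)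
    (δ : ℝ) (hδ : 0 < δ) (hδ1 : δ ≤ 1)
    (hvar : 6 * Bg ^ 2 / (Bs : ℝ) ^ 2 ≤ ϖ ^ 2)
    -- the order of the Rényi divergence at which the privacy loss is evaluated
    (o : ℝ) (ho : o = 1 + ϖ * Q / Bg * Real.sqrt (Real.log (1 / δ) / (20 * K)))
    (hord : o ≤ -Real.log (Bs * (ϖ ^ 2 * (Bs : ℝ) ^ 2 / (4 * Bg ^ 2) + 1) / Q)) :
    DPSCC.IsDP (DPSCC.randomness ν n Q Bs K σ)
      (DPSCC.Adjacent : (R → Fin Q → Ξ) → (R → Fin Q → Ξ) → Prop)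
      (A.algorithm f Bs K)
      (20 * Bg ^ 2 * K / (ϖ ^ 2 * (Q : ℝ) ^ 2)
        + 2 * Bg * Real.sqrt (20 * K * Real.log (1 / δ)) / (ϖ * Q))
      δ := by
  intro D D' hD T hT
  have hB : (0 : ℝ) < Bs := by exact_mod_cast hBs
  have hQ : (0 : ℝ) < Q := by exact_mod_cast hBs.trans_le hBsQ
  have hK' : (0 : ℝ) < K := by exact_mod_cast hK
  have := DPSCC.isProbabilityMeasure_batchLaw hBsQ
  have := fun σ => DPSCC.isProbabilityMeasure_gaussianNoise n σ
  let μ : ℕ → Measure (R → Finset (Fin Q) × DPSCC.Vec n) := fun k =>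
    Measure.pi fun i => (DPSCC.batchLaw Q Bs).prod (DPSCC.gaussianNoise n (σ i k))
  have hμ : ∀ k, IsProbabilityMeasure (μ k) := fun k => by infer_instance
  have hrand : DPSCC.randomness ν n Q Bs K σ = ν.prod (Measure.pi fun k : Fin K => μ k) := rfl
  rw [hrand]
  -- For δ = 1 the order degenerates to 1 and has no conjugate exponent, but the claim is trivial.
  rcases hδ1.eq_or_lt with rfl | hδ1
  · have h1 := measureReal_le_one (μ := ν.prod (Measure.pi fun k : Fin K => μ k))
      (s := {ω | A.algorithm f Bs K D ω ∈ T})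
    have h2 := measureReal_nonneg (μ := ν.prod (Measure.pi fun k : Fin K => μ k))
      (s := {ω | A.algorithm f Bs K D' ω ∈ T})
    have h3 := mul_nonneg (Real.exp_pos (20 * Bg ^ 2 * K / (ϖ ^ 2 * (Q : ℝ) ^ 2)
        + 2 * Bg * Real.sqrt (20 * K * Real.log (1 / 1)) / (ϖ * Q))).le h2
    linarith
  set l := Real.log (1 / δ) with hl
  have hl0 : 0 < l := Real.log_pos (by rw [lt_div_iff₀ hδ]; linarith)
  set s := Real.sqrt (l / (20 * K)) with hs
  have hs0 : 0 < s := Real.sqrt_pos.2 (by positivity)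
  have hls : l = 20 * K * s ^ 2 := by
    rw [hs, Real.sq_sqrt (by positivity)]; field_simp
  have ho1 : 1 < o := by
    rw [ho]
    have : 0 < ϖ * Q / Bg * s := by positivity
    linarith
  set u := 4 * Bg ^ 2 / (ϖ ^ 2 * (Bs : ℝ) ^ 2) with hu
  have hu0 : 0 < u := by positivity
  have hu1 : u ≤ 2 / 3 := by
    rw [div_le_iff₀ (by positivity)] at hvar
    rw [hu, div_le_iff₀ (by positivity)]
    linarith
  have hexp : Bs * (ϖ ^ 2 * (Bs : ℝ) ^ 2 / (4 * Bg ^ 2) + 1) / Q ≤ Real.exp (-o) := by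
    rw [← Real.log_le_iff_le_exp (by positivity)]
    linarith
  -- As ϖ²Bs²/(4Bg²) = 1/u, the condition on the order reads q(1+u)/u ≤ e^(-o).
  have hq : (Bs : ℝ) / Q ≤ Real.exp (-o) * (u / (1 + u)) := by
    have e : (Bs : ℝ) / Q
        = Bs * (ϖ ^ 2 * (Bs : ℝ) ^ 2 / (4 * Bg ^ 2) + 1) / Q * (u / (1 + u)) := by
      rw [hu]; field_simp
    rw [e]
    gcongr
  -- The same condition excludes full batches, so batches avoiding the changed sample exist.
  have hBsQ' : Bs < Q := by
    have h1 : (Bs : ℝ) / Q < 1 := by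
      refine hq.trans_lt ?_
      have h2 : Real.exp (-o) < 1 := Real.exp_lt_one_iff.2 (by linarith)
      have h3 := div_one_add_le hu0 hu1
      have h4 : 0 < u / (1 + u) := by positivity
      nlinarith [Real.exp_pos (-o)]
    rw [div_lt_one hQ] at h1
    exact_mod_cast h1
  have hpo : (o.conjExponent).HolderConjugate o := (Real.HolderConjugate.conjExponent ho1).symm
  have key := DPSCC.algorithm_measure_le A hclip hattack ν f D D' μ hpo
    (fun t k g F hF => DPSCC.lintegral_maskedRow_le A f hbound hBs hBsQ' hϖ hσ hu hu0 hu1 hpo hq hD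
      t k g hF) K hT
  have hinv : 1 / o.conjExponent = 1 - 1 / o := by
    rw [one_div, one_div, hpo.symm.one_sub_inv]
  set a := 20 * Bg ^ 2 * K / (ϖ ^ 2 * (Q : ℝ) ^ 2) with ha
  have hC : ENNReal.ofReal (1 + 5 * o * (o - 1) * ((Bs : ℝ) / Q) ^ 2 * u) ^ (1 / o)
      ≤ ENNReal.ofReal (Real.exp (5 * (o - 1) * ((Bs : ℝ) / Q) ^ 2 * u)) := by
    have h1 : 1 + 5 * o * (o - 1) * ((Bs : ℝ) / Q) ^ 2 * u
        ≤ Real.exp (5 * o * (o - 1) * ((Bs : ℝ) / Q) ^ 2 * u) := by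
      rw [add_comm]; exact Real.add_one_le_exp _
    refine (ENNReal.rpow_le_rpow (ENNReal.ofReal_le_ofReal h1) (by positivity)).trans (le_of_eq ?_)
    rw [ENNReal.ofReal_rpow_of_pos (Real.exp_pos _), ← Real.exp_mul]
    congr 2
    field_simp
  have hCK : (ENNReal.ofReal (1 + 5 * o * (o - 1) * ((Bs : ℝ) / Q) ^ 2 * u) ^ (1 / o)) ^ K
      ≤ ENNReal.ofReal (Real.exp ((o - 1) * a)) := by
    -- Bs cancels: 5q²u = 20Bg²/(ϖ²Q²), which summed over K iterations is a.
    refine (pow_le_pow_left₀ zero_le hC K).trans (le_of_eq ?_)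
    rw [← ENNReal.ofReal_pow (Real.exp_pos _).le, ← Real.exp_nat_mul]
    congr 2
    rw [hu, ha]
    field_simp
    ring
  have hreal := ENNReal.toReal_mono (ENNReal.mul_ne_top ENNReal.ofReal_ne_top
    (ENNReal.rpow_ne_top_of_nonneg (one_div_nonneg.2 hpo.pos.le) (measure_ne_top _ _))) (key.trans (mul_le_mul_left hCK _))
  rw [ENNReal.toReal_mul, ENNReal.toReal_ofReal (Real.exp_pos _).le, ← ENNReal.toReal_rpow, hinv]
    at hreal
  -- o - 1 = √(l/a) balances a(o - 1) with l/(o - 1); each equals √(al), whence the factor 2.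
  have hε : a + 2 * Bg * Real.sqrt (20 * K * l) / (ϖ * Q) = a * o + l / (o - 1) := by
    have h1 : Real.sqrt (20 * K * l) = 20 * K * s := by
      rw [hls, show 20 * (K : ℝ) * (20 * K * s ^ 2) = (20 * K * s) ^ 2 by ring,
        Real.sqrt_sq (by positivity)]
    rw [h1, ho, hls, ha, add_sub_cancel_left]
    field_simp
    ring
  rw [hε]
  exact le_exp_mul_add_of_le_exp_mul_rpow ho1 hδ measureReal_nonneg hreal
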